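/- Let $r\in\mathbf{N}\cup\{\infty\}$ (where $r=0$ is the topological case), let $M$ be a closed $C^r$-manifold (compact, Hausdorff, without boundary, of some dimension $m\ge 0$, not necessarily connected), let $n\geq 1$, and let $Z$ be a $C^r$-manifold that is $C^r$-diffeomorphic to $M\times\mathbf{R}^n$. Then each of the groups $\mathrm{Homeo}_c(Z)$, $\mathrm{Homeo}_{c,0}(Z)$, $\mathrm{Diff}^r_c(Z)$ and $\mathrm{Diff}^r_{c,0}(Z)$ is boundedly acyclic as an abstract group. Here $\mathrm{Homeo}_c(Z)$ and $\mathrm{Diff}^r_c(Z)$ are the groups of compactly supported homeomorphisms, respectively $C^r$-diffeomorphisms, of $Z$. Their neutral components $\mathrm{Homeo}_{c,0}(Z)$ and $\mathrm{Diff}^r_{c,0}(Z)$ are the unions, over all compact sets $K\subseteq Z$, of the connected components of the identity in the group of homeomorphisms, respectively $C^r$-diffeomorphisms, supported in $K$, endowed with the $C^0$-topology (the compact-open topology), respectively the $C^r$-topology (uniform convergence on compact sets, in charts, of all derivatives of finite order at most $r$). A group $G$ is boundedly acyclic if its bounded cohomology $H_b^q(G)$ with trivial real coefficients vanishes for all $q>0$;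 here $H_b^\bullet(G)$ is the cohomology of the complex of bounded functions invariant under the diagonal action \[ 0 \longrightarrow \ell^\infty(G)^G \longrightarrow \ell^\infty(G^2)^G \longrightarrow \ell^\infty(G^3)^G \longrightarrow \cdots \] with the differentials given by the alternating sums of the maps omitting one variable. -/

import Mathlib

open scoped Manifold ContDiff Topology

/-! ### Bounded cohomology of a discrete group with trivial real coefficients -/

noncomputable section BoundedCohomology

variable (G : Type*)

/-- The homogeneous coboundary map: the alternating sum over the ways to omit one variable. -/
def homogeneousCoboundary (n : ℕ) :
    ((Fin (n + 1) → G) → ℝ) →ₗ[ℝ] ((Fin (n + 2) → G) → ℝ) where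
  toFun f x := ∑ i : Fin (n + 2), (-1 : ℝ) ^ (i : ℕ) * f (fun j => x (i.succAbove j))
  map_add' f g := by
    ext x
    simp [mul_add, Finset.sum_add_distrib]
  map_smul' c f := by
    ext x
    simp only [Pi.smul_apply, smul_eq_mul, RingHom.id_apply, Finset.mul_sum]
    exact Finset.sum_congr rfl fun i _ => by ring

theorem homogeneousCoboundary_comp {n : ℕ} (f : (Fin (n + 1) → G) → ℝ) :
    homogeneousCoboundary G (n + 1) (homogeneousCoboundary G n f) = 0 := by
  ext x
  simp only [homogeneousCoboundary, LinearMap.coe_mk, AddHom.coe_mk, Finset.mul_sum,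
    Pi.zero_apply]
  rw [← Fintype.sum_prod_type']
  refine Finset.sum_involution
    (fun p _ => ((p.1.succAbove p.2, p.2.predAbove p.1) : Fin (n + 3) × Fin (n + 2)))
    ?_ ?_ (fun _ _ => Finset.mem_univ _) ?_
  · rintro ⟨i, j⟩ -
    have h1 : ∀ k, (i.succAbove j).succAbove ((j.predAbove i).succAbove k)
        = i.succAbove (j.succAbove k) :=
      fun k => Fin.succAbove_succAbove_succAbove_predAbove i j k
    have h2 : (-1 : ℝ) ^ ((i.succAbove j : ℕ) + (j.predAbove i : ℕ))
        = -(-1 : ℝ) ^ ((i : ℕ) + (j : ℕ)) :=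
      Fin.neg_one_pow_succAbove_add_predAbove i j
    simp only [h1]
    rw [← mul_assoc, ← mul_assoc, ← pow_add, ← pow_add, h2]
    ring
  · rintro ⟨i, j⟩ - - h
    exact Fin.succAbove_ne i j (congrArg Prod.fst h)
  · rintro ⟨i, j⟩ -
    exact Prod.ext (Fin.succAbove_succAbove_predAbove i j)
      (Fin.predAbove_predAbove_succAbove i j)

variable [Group G]

/-- `ℓ^∞(G^{n+1})^G`: bounded real functions on `G^{n+1}` which are invariant under the diagonal
action of `G` by left translations. -/
def boundedCochains (n : ℕ) : Submodule ℝ ((Fin (n + 1) → G) → ℝ) where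
  carrier := {f | (∃ C : ℝ, ∀ x, |f x| ≤ C) ∧ ∀ (g : G) (x : Fin (n + 1) → G),
    f (fun i => g * x i) = f x}
  zero_mem' := ⟨⟨0, by simp⟩, by simp⟩
  add_mem' := by
    rintro a b ⟨⟨C, hC⟩, ha⟩ ⟨⟨D, hD⟩, hb⟩
    refine ⟨⟨C + D, fun x => ?_⟩, fun g x => ?_⟩
    · exact (abs_add_le _ _).trans (add_le_add (hC x) (hD x))
    · simp [ha g x, hb g x]
  smul_mem' := by
    rintro c a ⟨⟨C, hC⟩, ha⟩
    refine ⟨⟨|c| * C, fun x => ?_⟩, fun g x => ?_⟩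
    · simpa [abs_mul] using mul_le_mul_of_nonneg_left (hC x) (abs_nonneg c)
    · simp [ha g x]

variable {G}

theorem homogeneousCoboundary_mem {n : ℕ} {f : (Fin (n + 1) → G) → ℝ}
    (h : f ∈ boundedCochains G n) : homogeneousCoboundary G n f ∈ boundedCochains G (n + 1) := by
  obtain ⟨⟨C, hC⟩, hf⟩ := h
  refine ⟨⟨∑ _i : Fin (n + 2), C, fun x => ?_⟩, fun g x => ?_⟩
  · change |∑ i : Fin (n + 2), (-1 : ℝ) ^ (i : ℕ) * f (fun j => x (i.succAbove j))| ≤ _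
    refine (Finset.abs_sum_le_sum_abs _ _).trans (Finset.sum_le_sum fun i _ => ?_)
    simpa [abs_mul] using hC _
  · change ∑ i : Fin (n + 2), (-1 : ℝ) ^ (i : ℕ) * f (fun j => g * x (i.succAbove j)) =
      ∑ i : Fin (n + 2), (-1 : ℝ) ^ (i : ℕ) * f (fun j => x (i.succAbove j))
    exact Finset.sum_congr rfl fun i _ => congrArg _ (hf g (fun j => x (i.succAbove j)))

variable (G)

/-- Cocycles of degree `n` in the complex `ℓ^∞(G^{n+1})^G`. -/
def boundedCocycles (n : ℕ) : Submodule ℝ ((Fin (n + 1) → G) → ℝ) :=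
  boundedCochains G n ⊓ LinearMap.ker (homogeneousCoboundary G n)

/-- Coboundaries of degree `n` in the complex `ℓ^∞(G^{n+1})^G`: coboundaries of bounded invariant
cochains of degree `n - 1`, and only `0` if `n = 0`. -/
def boundedCoboundaries : (n : ℕ) → Submodule ℝ ((Fin (n + 1) → G) → ℝ)
  | 0 => ⊥
  | n + 1 => (boundedCochains G n).map (homogeneousCoboundary G n)

theorem boundedCoboundaries_le (n : ℕ) : boundedCoboundaries G n ≤ boundedCocycles G n := by
  cases n with
  | zero => exact bot_le
  | succ n =>
    rintro _ ⟨f, hf, rfl⟩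
    exact ⟨homogeneousCoboundary_mem hf, homogeneousCoboundary_comp G f⟩

/-- The bounded cohomology `H_b^n(G)` with real coefficients: the cohomology of the complex
`0 → ℓ^∞(G)^G → ℓ^∞(G²)^G → ℓ^∞(G³)^G → ⋯`. -/
abbrev BoundedCohomology (n : ℕ) : Type _ :=
  boundedCocycles G n ⧸ (boundedCoboundaries G n).submoduleOf (boundedCocycles G n)

/-- A group is boundedly acyclic if `H_b^n(G) = 0` for all `n > 0`. -/
def BoundedlyAcyclic : Prop :=
  ∀ n : ℕ, 0 < n → Subsingleton (BoundedCohomology G n)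

end BoundedCohomology

/-! ### Compactly supported elements and their neutral component, for a group acting on a space -/

section CompactSupport

variable {G X : Type*} [Group G] [TopologicalSpace X]

/-- The (closed) support of a permutation of a topological space. -/
def permSupport (σ : Equiv.Perm X) : Set X := closure {x | σ x ≠ x}

theorem permSupport_one : permSupport (1 : Equiv.Perm X) = ∅ := by simp [permSupport]

theorem permSupport_mul (σ τ : Equiv.Perm X) :
    permSupport (σ * τ) ⊆ permSupport σ ∪ permSupport τ := by
  rw [permSupport, permSupport, permSupport, ← closure_union]
  refine closure_mono fun x hx => ?_
  by_contra h
  simp only [Set.mem_union, Set.mem_ofPred_eq, not_or, not_not] at h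
  exact hx (by rw [Equiv.Perm.mul_apply, h.2, h.1])

theorem permSupport_inv (σ : Equiv.Perm X) : permSupport σ⁻¹ = permSupport σ := by
  have : {x | σ⁻¹ x ≠ x} = {x | σ x ≠ x} := by
    ext x
    rw [Set.mem_ofPred_eq, Set.mem_ofPred_eq, ne_eq, Equiv.Perm.inv_eq_iff_eq, eq_comm]
  rw [permSupport, permSupport, this]

/-- The subgroup of the elements of `G` which act with compact support. -/
def compactSupportSubgroup (φ : G →* Equiv.Perm X) : Subgroup G where
  carrier := {g | IsCompact (permSupport (φ g))}
  one_mem' := by simp [permSupport_one]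
  mul_mem' {a b} ha hb := by
    refine (IsCompact.union ha hb).of_isClosed_subset isClosed_closure ?_
    rw [map_mul]
    exact permSupport_mul _ _
  inv_mem' {a} ha := by
    simpa only [Set.mem_ofPred_eq, map_inv, permSupport_inv] using ha

/-- The subgroup of the elements of `G` whose support is contained in `K`. -/
def supportedIn (φ : G →* Equiv.Perm X) (K : Set X) : Subgroup G where
  carrier := {g | permSupport (φ g) ⊆ K}
  one_mem' := by simp [permSupport_one]
  mul_mem' {a b} ha hb := by
    simp only [Set.mem_ofPred_eq, map_mul]
    exact (permSupport_mul _ _).trans (Set.union_subset ha hb)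
  inv_mem' {a} ha := by
    simpa only [Set.mem_ofPred_eq, map_inv, permSupport_inv] using ha

theorem supportedIn_mono (φ : G →* Equiv.Perm X) {K L : Set X} (h : K ⊆ L) :
    supportedIn φ K ≤ supportedIn φ L :=
  fun _ hg => Set.Subset.trans hg h

/-- For `G` endowed with a topology, the neutral component of the group of compactly supported
elements: the union, over the compact sets `K`, of the neutral components of the groups of elements
supported in `K` (each with the subspace topology). -/
def compactSupportNeutral [TopologicalSpace G] (φ : G →* Equiv.Perm X)
    (hG : ∀ g : G, Continuous fun h : G => h * g) : Subgroup G where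
  carrier := {g | ∃ K : Set X, IsCompact K ∧
    g ∈ connectedComponentIn (supportedIn φ K : Set G) 1}
  one_mem' := ⟨∅, isCompact_empty, mem_connectedComponentIn (one_mem _)⟩
  mul_mem' := by
    rintro a b ⟨K, hK, ha⟩ ⟨L, hL, hb⟩
    refine ⟨K ∪ L, hK.union hL, ?_⟩
    have ha' := connectedComponentIn_mono 1 (supportedIn_mono φ (Set.subset_union_left (t := L))) ha
    have hb' := connectedComponentIn_mono 1 (supportedIn_mono φ (Set.subset_union_right (s := K))) hb
    have hbF := connectedComponentIn_subset _ _ hb'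
    rw [connectedComponentIn_eq hb']
    have hc := (isPreconnected_connectedComponentIn (x := (1 : G))
      (F := (supportedIn φ (K ∪ L) : Set G))).image (fun h => h * b) (hG b).continuousOn
    refine hc.subset_connectedComponentIn
      ⟨1, mem_connectedComponentIn (one_mem _), one_mul b⟩ ?_ ⟨a, ha', rfl⟩
    rintro _ ⟨c, hc, rfl⟩
    exact mul_mem (connectedComponentIn_subset _ _ hc) hbF
  inv_mem' := by
    rintro a ⟨K, hK, ha⟩
    refine ⟨K, hK, ?_⟩
    have haF := connectedComponentIn_subset _ _ ha
    have hc := (isPreconnected_connectedComponentIn (x := (1 : G))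
      (F := (supportedIn φ K : Set G))).image (fun h => h * a⁻¹) (hG a⁻¹).continuousOn
    refine hc.subset_connectedComponentIn
      ⟨a, ha, mul_inv_cancel a⟩ ?_ ⟨1, mem_connectedComponentIn (one_mem _), one_mul _⟩
    rintro _ ⟨c, hc, rfl⟩
    exact mul_mem (connectedComponentIn_subset _ _ hc) (inv_mem haF)

end CompactSupport

/-! ### Homeomorphism groups -/

section Homeo

variable (Z : Type*) [TopologicalSpace Z]

/-- The action of `Homeo(Z)` on `Z`. -/
def homeoPerm : (Z ≃ₜ Z) →* Equiv.Perm Z where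
  toFun f := f.toEquiv
  map_one' := rfl
  map_mul' _ _ := rfl

/-- The `C⁰`-topology (compact-open topology) on `Homeo(Z)`. -/
instance homeoTopology : TopologicalSpace (Z ≃ₜ Z) :=
  TopologicalSpace.induced (fun f => (f : C(Z, Z))) inferInstance

theorem homeo_continuous_mul_right (g : Z ≃ₜ Z) : Continuous fun h : Z ≃ₜ Z => h * g :=
  continuous_induced_rng.2 <|
    (ContinuousMap.continuous_precomp (X := Z) (Y := Z) (Z := Z) (g : C(Z, Z))).comp
      (continuous_induced_dom (f := fun f : Z ≃ₜ Z => (f : C(Z, Z))))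

/-- `Homeo_c(Z)`. -/
def HomeoC : Subgroup (Z ≃ₜ Z) := compactSupportSubgroup (homeoPerm Z)

/-- `Homeo_{c,0}(Z)`. -/
def HomeoC0 : Subgroup (Z ≃ₜ Z) :=
  compactSupportNeutral (homeoPerm Z) (homeo_continuous_mul_right Z)

end Homeo

/-! ### Diffeomorphism groups of manifolds without boundary -/

noncomputable section Diffeo

variable (d : ℕ) (r : ℕ∞) (Z : Type*) [TopologicalSpace Z]
  [ChartedSpace (EuclideanSpace ℝ (Fin d)) Z]

/-- The set `Diff^r(Z)` for `Z` modelled on `ℝᵈ`; a `C⁰`-diffeomorphism is a homeomorphism. -/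
abbrev DiffR : Type _ := Diffeomorph (𝓡 d) (𝓡 d) Z Z r

/-- `Diff^r(Z)` is a group under composition. -/
instance diffGroup : Group (DiffR d r Z) where
  mul f g := Diffeomorph.trans g f
  mul_assoc _ _ _ := rfl
  one := Diffeomorph.refl (𝓡 d) Z r
  one_mul _ := rfl
  mul_one _ := rfl
  inv f := f.symm
  inv_mul_cancel f := f.self_trans_symm

/-- The action of `Diff^r(Z)` on `Z`. -/
def diffPerm : DiffR d r Z →* Equiv.Perm Z where
  toFun f := f.toEquiv
  map_one' := rfl
  map_mul' _ _ := rfl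

variable {d r Z}

/-- The set of the diffeomorphisms `g` which map the compact set `K`, contained in the domain of the
chart `a`, into the domain of the chart `b`, and whose expression in these charts has all its
derivatives of order at most `k` within `ε` of those of `f` on `a(K)`. -/
def diffNhd (f : DiffR d r Z) (a b : OpenPartialHomeomorph Z (EuclideanSpace ℝ (Fin d)))
    (K : Set Z) (k : ℕ) (ε : ℝ) : Set (DiffR d r Z) :=
  {g | g '' K ⊆ b.source ∧ ∀ j : ℕ, j ≤ k → ∀ z ∈ K,
    ‖iteratedFDeriv ℝ j (b ∘ g ∘ a.symm) (a z) - iteratedFDeriv ℝ j (b ∘ f ∘ a.symm) (a z)‖ < ε}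

variable (d r Z)

/-- The `C^r`-topology on `Diff^r(Z)`: uniform convergence on compact sets, in `C^r`-charts, of all
derivatives of finite order at most `r`. It is generated by the sets `diffNhd f a b K k ε`, with `a`
and `b` in the maximal `C^r`-atlas, `K` a compact subset of the domain of `a` such that `f(K)` lies
in the domain of `b`, `k ≤ r` finite, and `ε > 0`. -/
instance diffTopology : TopologicalSpace (DiffR d r Z) :=
  TopologicalSpace.generateFrom
    {U | ∃ (f : DiffR d r Z) (a b : OpenPartialHomeomorph Z (EuclideanSpace ℝ (Fin d)))
      (K : Set Z) (k : ℕ) (ε : ℝ),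
      a ∈ IsManifold.maximalAtlas (𝓡 d) r Z ∧ b ∈ IsManifold.maximalAtlas (𝓡 d) r Z ∧
      IsCompact K ∧ K ⊆ a.source ∧ f '' K ⊆ b.source ∧ (k : ℕ∞) ≤ r ∧ 0 < ε ∧
      U = diffNhd f a b K k ε}

theorem diff_continuous_mul_right [IsManifold (𝓡 d) r Z] (g : DiffR d r Z) :
    Continuous fun h : DiffR d r Z => h * g := by
  refine continuous_generateFrom_iff.2 ?_
  rintro _ ⟨f, a, b, K, k, ε, ha, hb, hK, hKa, hfK, hk, hε, rfl⟩
  apply TopologicalSpace.isOpen_generateFrom_of_mem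
  let a' := g.symm.toHomeomorph.toOpenPartialHomeomorph.trans a
  have ha' : a' ∈ IsManifold.maximalAtlas (𝓡 d) r Z := by
    rw [IsManifold.mem_maximalAtlas_iff_contMDiffOn] at ha ⊢
    constructor
    · exact ha.1.comp g.symm.contMDiff.contMDiffOn (fun x hx => by simpa [a'] using hx)
    · exact g.contMDiff.comp_contMDiffOn (ha.2.mono (fun x hx => by simpa [a'] using hx))
  have hgi : ∀ x : Z, g.symm (g x) = x := g.symm_apply_apply
  have ha'z : ∀ z : Z, a' (g z) = a z := fun z => congrArg a (hgi z)
  have hf : b ∘ ⇑(f * g⁻¹ : DiffR d r Z) ∘ a'.symm = b ∘ f ∘ a.symm :=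
    funext fun x => congrArg (fun y => b (f y)) (hgi _)
  have hh : ∀ h : DiffR d r Z, b ∘ ⇑h ∘ a'.symm = b ∘ ⇑(h * g : DiffR d r Z) ∘ a.symm :=
    fun _ => rfl
  refine ⟨f * g⁻¹, a', b, g '' K, k, ε, ha', hb, hK.image g.continuous, ?_, ?_, hk, hε, ?_⟩
  · rintro _ ⟨x, hx, rfl⟩
    simpa [a', hgi] using hKa hx
  · rintro _ ⟨_, ⟨x, hx, rfl⟩, rfl⟩
    exact hfK ⟨x, hx, congrArg f (hgi x).symm⟩
  · ext h
    rw [Set.mem_preimage, diffNhd, diffNhd, Set.mem_ofPred_eq, Set.mem_ofPred_eq,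
      Set.image_image, hf, hh]
    simp only [Set.forall_mem_image, ha'z]
    rfl

/-- `Diff^r_c(Z)`. -/
def DiffC : Subgroup (DiffR d r Z) := compactSupportSubgroup (diffPerm d r Z)

/-- `Diff^r_{c,0}(Z)`. -/
def DiffC0 [IsManifold (𝓡 d) r Z] : Subgroup (DiffR d r Z) :=
  compactSupportNeutral (diffPerm d r Z) (diff_continuous_mul_right d r Z)

end Diffeo

/-! Geometry enters only through displacement. A translation of `ℝⁿ`, cut off far from the origin,
acts on `M × ℝⁿ` with compact support because `M` is compact, and it is isotopic to the identity
through such maps. A high power `t` of a small one moves a given compact set off itself under every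
positive power of `t` (`exists_displacing_diffeo`). Hence every finite set of group elements lies in
a subgroup `H`, the elements supported in one compact set, that commutes with `t^i H t^{-i}` for all
`i ≥ 1`.

This property alone forces bounded acyclicity (`boundedlyAcyclic_of_commuting_conjugates`). Let `f`
be a bounded invariant cocycle. Right translating its variables by independent random elements and
averaging changes `f` by the coboundary of a cochain bounded in terms of `f` and its degree only
(`exists_homotopy_translate`). It remains to choose the random element so that the average is almost
constant on tuples from a given finite set `S ⊆ H`.

The choice is a lamplighter element `t^{-c} ∏ t^i u_i t^{-i}` with uniform cursor `c` and
independent random words `u_i` in `S`. As `f` is invariant under `t^j`, multiplying by letters of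
`S` has nearly the same effect on the average as altering, for each variable, the one lamp at
distance `j` beyond its cursor. This holds for each of many `j`, and by a law of large numbers an
alteration at a random `j` is almost invisible (`abs_average_lamp_sub_le`). The resulting
approximate primitives obey one common bound, so Tychonoff compactness yields an exact one. -/

/-- The alternating sum over the ways to omit one variable, including the augmentation in
degree `0`. -/
def altCoboundary {X : Type*} (n : ℕ) (f : (Fin n → X) → ℝ) (x : Fin (n + 1) → X) : ℝ :=
  ∑ i : Fin (n + 1), (-1 : ℝ) ^ (i : ℕ) * f (fun j => x (i.succAbove j))

/-! ### Chain homotopy between two pullbacks of cochains. -/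

section Prism

variable {X Y : Type*}

/-- Splitting off the face that omits the first variable makes the coboundary recursive in the same
way as the prism operator, which allows induction on the degree. -/
theorem altCoboundary_cons (n : ℕ) (f : (Fin (n + 1) → X) → ℝ) (a : X) (y : Fin (n + 1) → X) :
    altCoboundary (n + 1) f (Fin.cons a y : Fin (n + 2) → X) =
      f y - altCoboundary n (fun z => f (Fin.cons a z : Fin (n + 1) → X)) y := by
  have h : ∀ i : Fin (n + 1), (fun j : Fin (n + 1) =>
      (Fin.cons a y : Fin (n + 2) → X) (i.succ.succAbove j)) =
      (Fin.cons a (fun j => y (i.succAbove j)) : Fin (n + 1) → X) := by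
    intro i
    ext j
    cases j using Fin.cases <;> simp
  rw [altCoboundary, Fin.sum_univ_succ, altCoboundary, sub_eq_add_neg, ← Finset.sum_neg_distrib]
  congr 1
  · simp
  · refine Finset.sum_congr rfl fun i _ => ?_
    rw [h i, Fin.val_succ, pow_succ]
    ring

theorem altCoboundary_sub (n : ℕ) (f g : (Fin n → X) → ℝ) (x : Fin (n + 1) → X) :
    altCoboundary n (fun z => f z - g z) x = altCoboundary n f x - altCoboundary n g x := by
  simp only [altCoboundary, mul_sub, Finset.sum_sub_distrib]

theorem altCoboundary_const (n : ℕ) (c : ℝ) (x : Fin (n + 1) → X) :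
    altCoboundary n (fun _ => c) x = if Even n then c else 0 := by
  rw [altCoboundary, ← Finset.sum_mul, Fin.sum_univ_eq_sum_range (fun i => (-1 : ℝ) ^ i),
    neg_one_geom_sum]
  by_cases h : Even n <;> simp [Nat.even_add_one, h]

/-- The prism operator: the homotopy between the pullbacks of cochains along two maps. -/
def prism (s₀ s₁ : Y → X) : (n : ℕ) → ((Fin (n + 1) → X) → ℝ) → (Fin n → Y) → ℝ
  | 0, _, _ => 0
  | n + 1, f, y =>
      f (Fin.cons (s₀ (y 0)) (fun i => s₁ (y i)) : Fin (n + 2) → X) -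
        prism s₀ s₁ n (fun z => f (Fin.cons (s₀ (y 0)) z : Fin (n + 2) → X)) (fun i => y i.succ)

theorem prism_sub (s₀ s₁ : Y → X) (n : ℕ) (f g : (Fin (n + 1) → X) → ℝ) (y : Fin n → Y) :
    prism s₀ s₁ n (fun z => f z - g z) y = prism s₀ s₁ n f y - prism s₀ s₁ n g y := by
  induction n with
  | zero => simp [prism]
  | succ n ih =>
    simp only [prism]
    rw [ih]
    ring

theorem prism_homotopy (s₀ s₁ : Y → X) (n : ℕ) (f : (Fin (n + 1) → X) → ℝ) (y : Fin (n + 1) → Y) :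
    prism s₀ s₁ (n + 1) (altCoboundary (n + 1) f) y + altCoboundary n (prism s₀ s₁ n f) y =
      f (fun i => s₁ (y i)) - f (fun i => s₀ (y i)) := by
  induction n with
  | zero =>
    have h0 : (fun i => s₀ (y i)) = (Fin.cons (s₀ (y 0)) Fin.elim0 : Fin 1 → X) := by
      ext i
      fin_cases i
      rfl
    simp only [prism]
    rw [altCoboundary_cons]
    simp [altCoboundary, h0]
    congr
    ext i
    exact i.elim0
  | succ n ih =>
    obtain ⟨a, r, rfl⟩ : ∃ a r, y = (Fin.cons a r : Fin (n + 2) → Y) :=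
      ⟨y 0, Fin.tail y, (Fin.cons_self_tail y).symm⟩
    have hc : ∀ (s : Y → X) (k : ℕ) (z : Fin k → Y),
        (fun i => s ((Fin.cons a z : Fin (k + 1) → Y) i)) =
          (Fin.cons (s a) (fun i => s (z i)) : Fin (k + 1) → X) := by
      intro s k z
      ext i
      cases i using Fin.cases <;> simp
    rw [altCoboundary_cons]
    have hP : ∀ (k : ℕ) (F : (Fin (k + 2) → X) → ℝ) (z : Fin k → Y),
        prism s₀ s₁ (k + 1) F (Fin.cons a z : Fin (k + 1) → Y) =
          F (Fin.cons (s₀ a) (Fin.cons (s₁ a) (fun i => s₁ (z i)) : Fin (k + 1) → X)) -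
            prism s₀ s₁ k (fun w => F (Fin.cons (s₀ a) w : Fin (k + 2) → X)) z := by
      intro k F z
      simp only [prism, Fin.cons_zero, Fin.cons_succ, hc]
    simp only [hP, hc, altCoboundary_cons, altCoboundary_sub, prism_sub]
    have := ih (fun w => f (Fin.cons (s₀ a) w : Fin (n + 2) → X)) r
    have h2 : altCoboundary n (fun z : Fin n → Y => f (Fin.cons (s₀ a)
        (Fin.cons (s₁ a) (fun i => s₁ (z i)) : Fin (n + 1) → X))) r =
        altCoboundary n (fun z : Fin n → X => f (Fin.cons (s₀ a)
        (Fin.cons (s₁ a) z : Fin (n + 1) → X))) (fun i => s₁ (r i)) := rfl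
    rw [h2]
    linarith

theorem abs_prism_le (s₀ s₁ : Y → X) (n : ℕ) (f : (Fin (n + 1) → X) → ℝ) (B : ℝ)
    (hf : ∀ x, |f x| ≤ B) (y : Fin n → Y) : |prism s₀ s₁ n f y| ≤ n * B := by
  induction n with
  | zero => simp [prism]
  | succ n ih =>
    simp only [prism]
    refine (abs_sub _ _).trans ?_
    push_cast
    have := hf (Fin.cons (s₀ (y 0)) (fun i => s₁ (y i)) : Fin (n + 2) → X)
    have := ih (fun z => f (Fin.cons (s₀ (y 0)) z : Fin (n + 2) → X)) (fun _ => hf _)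
      (fun i => y i.succ)
    linarith

/-- Naturality of the prism; with `ρ` a left translation it gives invariance of the primitive. -/
theorem prism_comp (s₀ s₁ : Y → X) (σ : Y → Y) (ρ : X → X) (h₀ : ∀ y, s₀ (σ y) = ρ (s₀ y))
    (h₁ : ∀ y, s₁ (σ y) = ρ (s₁ y)) (n : ℕ) (f : (Fin (n + 1) → X) → ℝ) (y : Fin n → Y) :
    prism s₀ s₁ n f (fun i => σ (y i)) = prism s₀ s₁ n (fun z => f (fun i => ρ (z i))) y := by
  have hc : ∀ (k : ℕ) (a : X) (z : Fin k → X), (fun i => ρ ((Fin.cons a z : Fin (k + 1) → X) i)) =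
      (Fin.cons (ρ a) (fun i => ρ (z i)) : Fin (k + 1) → X) := by
    intro k a z
    ext i
    cases i using Fin.cases <;> simp
  induction n with
  | zero => simp [prism]
  | succ n ih => simp only [prism, h₀, h₁, ih, hc]

end Prism

/-! ### Averaging over independent right translations. -/

section Average

open scoped BigOperators

/-- A face of a cochain ignores one sample, and averaging over an ignored independent sample has no
effect. This is why averaging commutes with the coboundary. -/
theorem expect_succAbove {Ω : Type*} [Fintype Ω] [Nonempty Ω] (n : ℕ) (i : Fin (n + 1))
    (g : (Fin n → Ω) → ℝ) :
    𝔼 w : Fin (n + 1) → Ω, g (fun j => w (i.succAbove j)) = 𝔼 w, g w := by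
  rw [← Fintype.expect_equiv (Fin.insertNthEquiv (fun _ => Ω) i)
    (fun p => g p.2) _ (by intro p; simp), ← Finset.univ_product_univ, Finset.expect_product]
  simp

/-- The average of a cochain over independent samples in each variable. -/
noncomputable def averageCochain {X Ω : Type*} [Fintype Ω] (n : ℕ) (F : (Fin n → X × Ω) → ℝ)
    (x : Fin n → X) : ℝ :=
  𝔼 w : Fin n → Ω, F (fun i => (x i, w i))

theorem altCoboundary_averageCochain {X Ω : Type*} [Fintype Ω] [Nonempty Ω] (n : ℕ)
    (F : (Fin n → X × Ω) → ℝ) (x : Fin (n + 1) → X) :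
    altCoboundary n (averageCochain n F) x = averageCochain (n + 1) (altCoboundary n F) x := by
  simp only [altCoboundary, averageCochain]
  rw [Finset.expect_sum_comm]
  refine Finset.sum_congr rfl fun i _ => ?_
  rw [← Finset.mul_expect]
  congr 1
  exact (expect_succAbove n i (fun w => F (fun j => (x (i.succAbove j), w j)))).symm

theorem abs_expect_le_of_forall {ι : Type*} [Fintype ι] [Nonempty ι] (f : ι → ℝ) (B : ℝ)
    (h : ∀ i, |f i| ≤ B) : |𝔼 i, f i| ≤ B :=
  (Finset.abs_expect_le _ _).trans (Finset.expect_le Finset.univ_nonempty fun i _ => h i)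

/-- Averaging a bounded invariant cocycle over independent right translations changes it by the
coboundary of a bounded invariant cochain. -/
theorem exists_homotopy_translate {G Ω : Type*} [Group G] [Fintype Ω] [Nonempty Ω] (y : Ω → G)
    (n : ℕ) (f : (Fin (n + 1) → G) → ℝ) (B : ℝ) (hB : ∀ x, |f x| ≤ B)
    (hinv : ∀ (g : G) x, f (fun i => g * x i) = f x) (hf : ∀ x, altCoboundary (n + 1) f x = 0) :
    ∃ F : (Fin n → G) → ℝ, (∀ x, |F x| ≤ n * B) ∧ (∀ (g : G) x, F (fun i => g * x i) = F x) ∧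
      ∀ x, altCoboundary n F x = (𝔼 w : Fin (n + 1) → Ω, f (fun i => x i * y (w i))) - f x := by
  -- Samples become part of the variables: `s₀` forgets the sample, `s₁` translates by it. Both
  -- commute with left translations of `G`.
  let s₀ : G × Ω → G := fun p => p.1
  let s₁ : G × Ω → G := fun p => p.1 * y p.2
  refine ⟨averageCochain n (prism s₀ s₁ n f), fun x => ?_, fun g x => ?_, fun x => ?_⟩
  · exact abs_expect_le_of_forall _ _ fun w => abs_prism_le _ _ _ _ _ hB _
  · refine Finset.expect_congr rfl fun w _ => ?_
    have := prism_comp s₀ s₁ (fun p => (g * p.1, p.2)) (fun a => g * a) (fun _ => rfl)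
      (fun _ => mul_assoc _ _ _) n f (fun i => (x i, w i))
    rw [this]
    simp only [hinv]
  · have hf0 : altCoboundary (n + 1) f = fun _ => 0 := funext hf
    have hp : ∀ z, prism s₀ s₁ (n + 1) (fun _ => (0 : ℝ)) z = 0 := by
      intro z
      have := abs_prism_le s₀ s₁ (n + 1) (fun _ => (0 : ℝ)) 0 (by simp) z
      simpa using this
    rw [altCoboundary_averageCochain, averageCochain]
    have : ∀ w : Fin (n + 1) → Ω, altCoboundary n (prism s₀ s₁ n f) (fun i => (x i, w i)) =
        f (fun i => x i * y (w i)) - f x := by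
      intro w
      have := prism_homotopy s₀ s₁ n f (fun i => (x i, w i))
      rw [hf0, hp, zero_add] at this
      exact this
    simp only [this]
    rw [Finset.expect_sub_distrib, Fintype.expect_const]

end Average

/-! ### Densities and a law of large numbers. -/

section FibreCount

open scoped BigOperators
open Classical in
/-- The number of preimages of a point: the density of the image of the uniform measure. -/
noncomputable def fibreCount {α : Type*} [Fintype α] (ρ : α → α) (b : α) : ℝ :=
  ((Finset.univ.filter fun a => ρ a = b).card : ℝ)

theorem fibreCount_nonneg {α : Type*} [Fintype α] (ρ : α → α) (b : α) : 0 ≤ fibreCount ρ b :=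
  Nat.cast_nonneg _

theorem expect_comp_eq_expect_fibreCount_mul {α : Type*} [Fintype α] (ρ : α → α) (f : α → ℝ) :
    𝔼 a, f (ρ a) = 𝔼 b, fibreCount ρ b * f b := by
  classical
  rw [Fintype.expect_eq_sum_div_card, Fintype.expect_eq_sum_div_card]
  congr 1
  rw [← Finset.sum_fiberwise_of_maps_to (s := Finset.univ) (t := Finset.univ) (g := ρ)
    (fun _ _ => Finset.mem_univ _)]
  refine Finset.sum_congr rfl fun b _ => ?_
  rw [Finset.sum_congr rfl (g := fun _ => f b)
    (fun a ha => by rw [(Finset.mem_filter.1 ha).2])]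
  rw [Finset.sum_const, nsmul_eq_mul, fibreCount]

/-- A quantitative law of large numbers: averaging over many independent modifications of bounded
density hardly changes the expectation of a bounded function. -/
theorem sq_expect_modification_sub_le {α ι : Type*} [Fintype α] [Nonempty α] [Fintype ι]
    [Nonempty ι] (R : ι → α → α) (C B : ℝ) (hC : ∀ j b, fibreCount (R j) b ≤ C)
    (hinv : ∀ j k, j ≠ k → ∀ a, fibreCount (R j) (R k a) = fibreCount (R j) a)
    (f : α → ℝ) (hB : ∀ a, |f a| ≤ B) :
    ((𝔼 j, 𝔼 a, f (R j a)) - 𝔼 a, f a) ^ 2 ≤ B ^ 2 * (C ^ 2 / Fintype.card ι) := by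
  classical
  have hone : ∀ j, 𝔼 a, fibreCount (R j) a = 1 := by
    intro j
    have := expect_comp_eq_expect_fibreCount_mul (R j) (fun _ => (1 : ℝ))
    simpa using this.symm
  -- The densities have mean one and, since `R j` preserves the density of `R k`, are pairwise
  -- uncorrelated. Their average therefore has variance at most `C ^ 2 / card ι`, and Cauchy–Schwarz
  -- concludes.
  have hcov : ∀ j k, j ≠ k → 𝔼 a, fibreCount (R j) a * fibreCount (R k) a = 1 := by
    intro j k hjk
    rw [← expect_comp_eq_expect_fibreCount_mul]
    simp only [hinv k j hjk.symm, hone]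
  let g : α → ℝ := fun a => 𝔼 j, (fibreCount (R j) a - 1)
  have hdiff : (𝔼 j, 𝔼 a, f (R j a)) - 𝔼 a, f a = 𝔼 a, f a * g a := by
    simp only [expect_comp_eq_expect_fibreCount_mul]
    rw [Finset.expect_comm, ← Finset.expect_sub_distrib]
    refine Finset.expect_congr rfl fun a _ => ?_
    simp only [g]
    rw [Finset.expect_sub_distrib, Fintype.expect_const, ← Finset.expect_mul]
    ring
  have hoff : ∀ j k, 𝔼 a, (fibreCount (R j) a - 1) * (fibreCount (R k) a - 1) ≤
      if j = k then C ^ 2 else 0 := by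
    intro j k
    have h1 : 𝔼 a, (fibreCount (R j) a - 1) * (fibreCount (R k) a - 1) =
        (𝔼 a, fibreCount (R j) a * fibreCount (R k) a) - 1 := by
      have : ∀ a, (fibreCount (R j) a - 1) * (fibreCount (R k) a - 1) =
        fibreCount (R j) a * fibreCount (R k) a - fibreCount (R j) a - fibreCount (R k) a + 1 :=
        fun a => by ring
      simp only [this]
      rw [Finset.expect_add_distrib, Finset.expect_sub_distrib, Finset.expect_sub_distrib, hone,
        hone, Fintype.expect_const]
      ring
    rw [h1]
    split_ifs with h
    · subst h
      have : 𝔼 a, fibreCount (R j) a * fibreCount (R j) a ≤ C ^ 2 :=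
        Finset.expect_le Finset.univ_nonempty fun a _ => by
          rw [sq]
          exact mul_self_le_mul_self (fibreCount_nonneg _ _) (hC j a)
      linarith
    · rw [hcov j k h, sub_self]
  have hg : 𝔼 a, g a ^ 2 ≤ C ^ 2 / Fintype.card ι := by
    have h1 : 𝔼 a, g a ^ 2 =
        𝔼 j, 𝔼 k, 𝔼 a, (fibreCount (R j) a - 1) * (fibreCount (R k) a - 1) := by
      have : ∀ a, g a ^ 2 = 𝔼 j, 𝔼 k, (fibreCount (R j) a - 1) * (fibreCount (R k) a - 1) := by
        intro a
        rw [sq, Fintype.expect_mul_expect]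
      simp only [this]
      rw [Finset.expect_comm]
      refine Finset.expect_congr rfl fun j _ => ?_
      rw [Finset.expect_comm]
    rw [h1]
    calc _ ≤ 𝔼 j : ι, 𝔼 k : ι, (if j = k then C ^ 2 else 0) :=
          Finset.expect_le_expect fun j _ => Finset.expect_le_expect fun k _ => hoff j k
      _ = C ^ 2 / Fintype.card ι := by
          simp only [Fintype.expect_eq_sum_div_card, Finset.sum_ite_eq, Finset.mem_univ, if_true,
            Finset.sum_const, Finset.card_univ, nsmul_eq_mul]
          field_simp
  rw [hdiff]
  calc (𝔼 a, f a * g a) ^ 2 ≤ (𝔼 a, f a ^ 2) * 𝔼 a, g a ^ 2 :=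
        Finset.expect_mul_sq_le_sq_mul_sq _ _ _
    _ ≤ B ^ 2 * (C ^ 2 / Fintype.card ι) := by
        refine mul_le_mul (Finset.expect_le Finset.univ_nonempty fun a _ => ?_) hg
          (Finset.expect_nonneg fun a _ => sq_nonneg _) (sq_nonneg _)
        exact sq_le_sq' (abs_le.1 (hB a)).1 (abs_le.1 (hB a)).2

theorem fibreCount_id {α : Type*} [Fintype α] (b : α) : fibreCount (fun a => a) b = 1 := by
  classical
  rw [fibreCount, Finset.card_eq_one.2 ⟨b, by ext; simp⟩, Nat.cast_one]

theorem fibreCount_pi {κ Ω : Type*} [Fintype κ] [Fintype Ω] [DecidableEq κ] (ρ : κ → Ω → Ω)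
    (b : κ → Ω) : fibreCount (fun (a : κ → Ω) k => ρ k (a k)) b = ∏ k, fibreCount (ρ k) (b k) := by
  classical
  simp only [fibreCount]
  rw [← Nat.cast_prod, ← Fintype.card_piFinset]
  congr 2
  ext a
  simp [funext_iff]

/-- Apply `T k` to the coordinates `k` in `P`. -/
def modifyOn {κ Ω : Type*} [DecidableEq κ] (T : κ → Ω → Ω) (P : Finset κ) (a : κ → Ω) (k : κ) : Ω :=
  if k ∈ P then T k (a k) else a k

theorem fibreCount_modifyOn {κ Ω : Type*} [Fintype κ] [Fintype Ω] [DecidableEq κ] (T : κ → Ω → Ω)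
    (P : Finset κ) (b : κ → Ω) :
    fibreCount (modifyOn T P) b = ∏ k ∈ P, fibreCount (T k) (b k) := by
  have h : fibreCount (modifyOn T P) b = _ :=
    fibreCount_pi (fun k w => if k ∈ P then T k w else w) b
  rw [h, ← Finset.prod_subset P.subset_univ]
  · refine Finset.prod_congr rfl fun k hk => ?_
    simp only [hk, if_true]
  · intro k _ hk
    simp only [hk, if_false, fibreCount_id]

/-- The law of large numbers for modifications supported on disjoint sets of coordinates. -/
theorem sq_expect_modifyOn_sub_le {κ Ω ι : Type*} [Fintype κ] [Fintype Ω] [DecidableEq κ]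
    [Nonempty Ω] [Fintype ι] [Nonempty ι] (T : κ → Ω → Ω) (P : ι → Finset κ)
    (hP : Pairwise fun i j => Disjoint (P i) (P j)) (N : ℕ) (hN : ∀ j, (P j).card = N) (C B : ℝ)
    (hC : ∀ k b, fibreCount (T k) b ≤ C) (f : (κ → Ω) → ℝ) (hB : ∀ a, |f a| ≤ B) :
    ((𝔼 j, 𝔼 a, f (modifyOn T (P j) a)) - 𝔼 a, f a) ^ 2 ≤
      B ^ 2 * ((C ^ N) ^ 2 / Fintype.card ι) := by
  refine sq_expect_modification_sub_le _ _ _ (fun j b => ?_) (fun j k hjk a => ?_) f hB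
  · rw [fibreCount_modifyOn, ← hN j, ← Finset.prod_const]
    exact Finset.prod_le_prod (fun k _ => fibreCount_nonneg _ _) fun k _ => hC k _
  · rw [fibreCount_modifyOn, fibreCount_modifyOn]
    refine Finset.prod_congr rfl fun i hi => ?_
    rw [modifyOn, if_neg (Finset.disjoint_left.1 (hP hjk) hi)]

theorem expect_apply_eq {κ Ω : Type*} [Fintype κ] [Fintype Ω] [DecidableEq κ] [Nonempty Ω] (k : κ)
    (g : Ω → ℝ) : 𝔼 a : κ → Ω, g (a k) = 𝔼 w, g w := by
  rw [← Fintype.expect_equiv (Equiv.funSplitAt k Ω).symm (fun p => g p.1) _ (by intro p; simp),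
    ← Finset.univ_product_univ, Finset.expect_product]
  simp

end FibreCount

/-! ### Random words of random length. -/

section RandomWord

open scoped BigOperators

/-- Random words of random length: left multiplication by a letter lifts, up to small probability,
to a map of bounded density on the sample space. -/
theorem exists_random_word {A H : Type*} [Finite A] [Nonempty A] [Monoid H] (v : A → H) (K : ℕ) :
    ∃ (Ω : Type) (_ : Fintype Ω) (_ : Nonempty Ω) (u : Ω → H) (T : A → Ω → Ω),
      (∀ a b, fibreCount (T a) b ≤ Nat.card A) ∧
      ∀ (a : A) [DecidablePred fun w => v a * u w = u (T a w)],
        𝔼 w, (if v a * u w = u (T a w) then (0 : ℝ) else 1) ≤ 1 / (K + 1) := by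
  classical
  obtain ⟨m, ⟨e⟩⟩ := Finite.exists_equiv_fin A
  have hm : Nat.card A = m := by rw [Nat.card_congr e, Nat.card_fin]
  have : Nonempty (Fin m) := e.nonempty_congr.1 inferInstance
  -- A sample is a length `k ≤ K` together with `K + 1` letters, of which only the first `k` are
  -- read.
  let u : Fin (K + 1) × (Fin (K + 1) → Fin m) → H := fun p =>
    (((List.ofFn p.2).take p.1).map fun i => v (e.symm i)).prod
  -- Prepend the letter, drop the last one and lengthen by one. The length wraps around only at `k =
  -- K`, the sole event where the identity may fail.
  let T : A → Fin (K + 1) × (Fin (K + 1) → Fin m) → Fin (K + 1) × (Fin (K + 1) → Fin m) :=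
    fun a p => (p.1 + 1, Fin.cons (e a) (Fin.init p.2))
  have hu : ∀ a p, p.1 ≠ Fin.last K → v a * u p = u (T a p) := by
    rintro a ⟨k, s⟩ hk
    have hk' : (k : ℕ) < K := Fin.val_lt_last hk
    have h1 : ((k + 1 : Fin (K + 1)) : ℕ) = k + 1 := by
      rw [Fin.val_add_one, if_neg hk]
    have h2 : List.ofFn s = List.ofFn (Fin.init s) ++ [s (Fin.last K)] := by
      rw [List.ofFn_succ', List.concat_eq_append]
      rfl
    simp only [u, T, h1]
    rw [List.ofFn_succ (f := Fin.cons (e a) (Fin.init s)), List.take_succ_cons,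
      List.map_cons, List.prod_cons]
    simp only [Fin.cons_zero, Fin.cons_succ, Equiv.symm_apply_apply]
    rw [h2, List.take_append_of_le_length (by simp [hk'.le])]
  refine ⟨Fin (K + 1) × (Fin (K + 1) → Fin m), inferInstance, inferInstance, u, T, ?_, ?_⟩
  · intro a b
    rw [fibreCount, hm]
    norm_cast
    -- A preimage is determined by the dropped letter, so the density bound does not depend on `K`.
    refine (Finset.card_le_card_of_injOn (t := (Finset.univ : Finset (Fin m)))
      (fun p => p.2 (Fin.last K)) (by simp) ?_).trans (by simp)
    rintro ⟨k, s⟩ hp ⟨k', s'⟩ hq hpq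
    simp only [Finset.coe_filter, Finset.mem_univ, true_and, Set.mem_ofPred_eq] at hp hq hpq
    have h := hp.trans hq.symm
    simp only [T, Prod.mk.injEq] at h
    have h3 : Fin.init s = Fin.init s' := (Fin.cons_inj.1 h.2).2
    rw [Prod.mk.injEq]
    refine ⟨add_right_cancel h.1, ?_⟩
    rw [← Fin.snoc_init_self s, ← Fin.snoc_init_self s', h3, hpq]
  · intro a _
    calc _ ≤ 𝔼 p : Fin (K + 1) × (Fin (K + 1) → Fin m),
          (if p.1 = Fin.last K then (1 : ℝ) else 0) := by
          refine Finset.expect_le_expect fun p _ => ?_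
          by_cases hp : p.1 = Fin.last K
          · rw [if_pos hp]
            split_ifs <;> norm_num
          · rw [if_pos (hu a p hp), if_neg hp]
      _ = 1 / (K + 1) := by
          rw [← Finset.univ_product_univ, Finset.expect_product]
          rw [Finset.expect_congr rfl fun i _ =>
            Fintype.expect_const (if i = Fin.last K then (1 : ℝ) else 0)]
          rw [Fintype.expect_eq_sum_div_card]
          simp

end RandomWord

/-! ### Lamplighter elements and almost invariance of their averages. -/

section Lamplighter

open scoped BigOperators

variable {G : Type*} [Group G]

/-- Conjugation by a power of `t`, on a subgroup. -/
def conjPow (H : Subgroup G) (t : G) (i : ℕ) : H →* G :=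
  (MulAut.conj (t ^ i)).toMonoidHom.comp H.subtype

theorem conjPow_apply (H : Subgroup G) (t : G) (i : ℕ) (h : H) :
    conjPow H t i h = t ^ i * h * (t ^ i)⁻¹ :=
  rfl

theorem commute_conjPow {H : Subgroup G} {t : G}
    (ht : ∀ i : ℕ, 1 ≤ i → ∀ a ∈ H, ∀ b ∈ H, Commute (t ^ i * a * (t ^ i)⁻¹) b) {L : ℕ} :
    Pairwise fun i j : Fin L => ∀ (x y : H),
      Commute (conjPow H t i x) (conjPow H t j y) := by
  have key : ∀ (i j : Fin L), i < j → ∀ x y : H,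
      Commute (conjPow H t i x) (conjPow H t j y) := by
    intro i j hij x y
    have hij' : (i : ℕ) < j := hij
    have h := (ht (j - i) (by omega) y y.2 x x.2).symm
    have h2 : t ^ (j : ℕ) = t ^ (i : ℕ) * t ^ (j - i : ℕ) := by
      rw [← pow_add]
      congr 1
      omega
    have h3 := h.map (MulAut.conj (t ^ (i : ℕ))).toMonoidHom
    change Commute (t ^ (i : ℕ) * x * (t ^ (i : ℕ))⁻¹)
      (t ^ (i : ℕ) * (t ^ (j - i : ℕ) * y * (t ^ (j - i : ℕ))⁻¹) * (t ^ (i : ℕ))⁻¹) at h3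
    rw [conjPow_apply, conjPow_apply, h2]
    simpa [mul_assoc] using h3
  intro i j hij x y
  rcases lt_or_gt_of_ne hij with h | h
  · exact key i j h x y
  · exact (key j i h y x).symm

/-- The element of the lamplighter group with cursor `c` and lamps `u`. -/
noncomputable def lamp {H : Subgroup G} {t : G}
    (ht : ∀ i : ℕ, 1 ≤ i → ∀ a ∈ H, ∀ b ∈ H, Commute (t ^ i * a * (t ^ i)⁻¹) b) {L : ℕ}
    (c : Fin L) (u : Fin L → H) : G :=
  (t ^ (c : ℕ))⁻¹ * MonoidHom.noncommPiCoprod _ (commute_conjPow ht (L := L)) u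

/-- With `d = c + j` one has `t^j h t^{-d} = t^{-c} (t^d h t^{-d})`, so `h` is absorbed into lamp
`d` while the cursor moves from `d` back to `c`. -/
theorem pow_mul_lamp {H : Subgroup G} {t : G}
    (ht : ∀ i : ℕ, 1 ≤ i → ∀ a ∈ H, ∀ b ∈ H, Commute (t ^ i * a * (t ^ i)⁻¹) b) {L : ℕ}
    (c d : Fin L) (j : ℕ) (hd : (d : ℕ) = c + j) (h : H) (u u' : Fin L → H)
    (hu : h * u d = u' d) (hu' : ∀ i, i ≠ d → u' i = u i) :
    t ^ j * (h * lamp ht d u) = lamp ht c u' := by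
  have h1 : u' = Pi.mulSingle d h * u := by
    ext i
    by_cases hi : i = d
    · subst hi
      simp [hu]
    · simp [hi, hu']
  rw [lamp, lamp, h1, map_mul, MonoidHom.noncommPiCoprod_mulSingle, hd]
  rw [conjPow_apply, add_comm, pow_add]
  group

theorem expect_wrap_le (L j : ℕ) :
    𝔼 c : Fin (L + 1), (if (c : ℕ) + j < L + 1 then (0 : ℝ) else 1) ≤ j / (L + 1) := by
  rw [Fintype.expect_eq_sum_div_card, Fintype.card_fin]
  push_cast
  gcongr
  have : ∀ c : Fin (L + 1), (if (c : ℕ) + j < L + 1 then (0 : ℝ) else 1) =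
      if L < (c : ℕ) + j then 1 else 0 := by
    intro c
    split_ifs <;> first | rfl | omega
  simp only [this]
  rw [Finset.sum_boole]
  norm_cast
  refine (Finset.card_le_card_of_injOn (t := Finset.range j)
    (fun c : Fin (L + 1) => L - (c : ℕ)) ?_ ?_).trans (Finset.card_range j).le
  · intro c hc
    simp only [Finset.coe_filter, Finset.mem_univ, true_and, Set.mem_ofPred_eq] at hc
    simp only [Finset.coe_range, Set.mem_Iio]
    omega
  · intro c hc c' hc' h
    simp only at h
    omega

/-- Splitting a family of pairs in an expectation. -/
theorem expect_lamp_split {N L : ℕ} {Ω : Type*} [Fintype Ω]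
    (g : (Fin N → Fin L × (Fin L → Ω)) → ℝ) :
    𝔼 w, g w =
      𝔼 c : Fin N → Fin L, 𝔼 a : Fin N × Fin L → Ω, g fun k => (c k, fun i => a (k, i)) := by
  rw [← Finset.expect_product', Finset.univ_product_univ]
  let e : (Fin N → Fin L × (Fin L → Ω)) ≃ (Fin N → Fin L) × (Fin N × Fin L → Ω) :=
    (Equiv.arrowProdEquivProdArrow _ _ _).trans
      (Equiv.prodCongr (Equiv.refl _) (Equiv.curry _ _ _).symm)
  exact Fintype.expect_equiv e _ _ fun _ => rfl

/-- The first error term bounds the probability that some cursor wraps around or some random word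
fails to absorb its letter; the second is the law of large numbers over `J` shifts. -/
theorem abs_average_lamp_sub_le {H : Subgroup G} {t : G}
    (ht : ∀ i : ℕ, 1 ≤ i → ∀ a ∈ H, ∀ b ∈ H, Commute (t ^ i * a * (t ^ i)⁻¹) b)
    {A Ω : Type*} [Fintype Ω] [Nonempty Ω] (v : A → H) (u : Ω → H) (T : A → Ω → Ω) (C δ : ℝ)
    (hC : ∀ a b, fibreCount (T a) b ≤ C)
    (hT : ∀ (a : A) [DecidablePred fun w => v a * u w = u (T a w)],
        𝔼 w, (if v a * u w = u (T a w) then (0 : ℝ) else 1) ≤ δ)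
    (N J L : ℕ) [NeZero J] (hJL : J ≤ L + 1) (f : (Fin N → G) → ℝ) (B : ℝ) (hB : ∀ x, |f x| ≤ B)
    (hinv : ∀ (g : G) x, f (fun i => g * x i) = f x) (x : Fin N → A) :
    |(𝔼 w : Fin N → Fin (L + 1) × (Fin (L + 1) → Ω),
        f (fun k => v (x k) * lamp ht (w k).1 (fun i => u ((w k).2 i)))) -
      𝔼 w : Fin N → Fin (L + 1) × (Fin (L + 1) → Ω),
        f (fun k => lamp ht (w k).1 (fun i => u ((w k).2 i)))| ≤
      2 * B * (N * (J / (L + 1) + δ)) + √(B ^ 2 * ((C ^ N) ^ 2 / J)) := by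
  classical
  have hB0 : 0 ≤ B := (abs_nonneg _).trans (hB fun _ => 1)
  rw [expect_lamp_split, expect_lamp_split]
  simp only
  set Ψ : (Fin N → Fin (L + 1)) → (Fin N × Fin (L + 1) → Ω) → ℝ := fun c a =>
    f (fun k => v (x k) * lamp ht (c k) (fun i => u (a (k, i)))) with hΨ
  set Φ : (Fin N → Fin (L + 1)) → (Fin N × Fin (L + 1) → Ω) → ℝ := fun c a =>
    f (fun k => lamp ht (c k) (fun i => u (a (k, i)))) with hΦ
  let T' : Fin N × Fin (L + 1) → Ω → Ω := fun p => T (x p.1)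
  let s : Fin J → Fin (L + 1) := Fin.castLE hJL
  -- The lamps altered by shift `j`, one per variable. They are disjoint for different `j`, as `J ≤
  -- L + 1`.
  let P : (Fin N → Fin (L + 1)) → Fin J → Finset (Fin N × Fin (L + 1)) := fun c j =>
    Finset.univ.image fun k => (k, c k + s j)
  have hPmem : ∀ c j p, p ∈ P c j ↔ p.2 = c p.1 + s j := by
    rintro c j ⟨k, i⟩
    simp [P, eq_comm]
  have hLLN : ∀ c, |(𝔼 j, 𝔼 a, Φ c (modifyOn T' (P c j) a)) - 𝔼 a, Φ c a| ≤
      √(B ^ 2 * ((C ^ N) ^ 2 / J)) := by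
    intro c
    apply Real.abs_le_sqrt
    have := sq_expect_modifyOn_sub_le T' (P c) ?_ N ?_ C B (fun p b => hC _ b) (Φ c) (fun a => hB _)
    · simpa using this
    · intro i j hij
      rw [Finset.disjoint_left]
      intro p hp hp'
      rw [hPmem] at hp hp'
      exact hij (Fin.castLE_injective hJL (add_left_cancel (hp.symm.trans hp')))
    · intro j
      rw [Finset.card_image_of_injective _ fun k k' h => congrArg Prod.fst h]
      simp
  -- Addition on `Fin (L + 1)` is cyclic, so shifting preserves the uniform cursors.
  have hshift : ∀ j, 𝔼 c, 𝔼 a, Ψ c a = 𝔼 c : Fin N → Fin (L + 1), 𝔼 a, Ψ (fun k => c k + s j) a := by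
    intro j
    exact (Fintype.expect_equiv (Equiv.addRight fun _ : Fin N => s j) _ _ fun c => rfl).symm
  let W : Fin J → Fin (L + 1) → ℝ := fun j c => if (c : ℕ) + j < L + 1 then 0 else 1
  let V : A → Ω → ℝ := fun a w => if v a * u w = u (T a w) then 0 else 1
  have hW0 : ∀ j c, 0 ≤ W j c := fun j c => by simp only [W]; split_ifs <;> norm_num
  have hV0 : ∀ a w, 0 ≤ V a w := fun j c => by simp only [V]; split_ifs <;> norm_num
  have hpt : ∀ j c a, |Ψ (fun k => c k + s j) a - Φ c (modifyOn T' (P c j) a)| ≤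
      2 * B * ∑ k, (W j (c k) + V (x k) (a (k, c k + s j))) := by
    intro j c a
    by_cases hgood : ∀ k, (c k : ℕ) + j < L + 1 ∧
        v (x k) * u (a (k, c k + s j)) = u (T (x k) (a (k, c k + s j)))
    · have : Ψ (fun k => c k + s j) a = Φ c (modifyOn T' (P c j) a) := by
        rw [hΨ, hΦ]
        simp only
        -- One power of `t` must serve all variables at once, so all cursors are shifted by the same
        -- `j`.
        rw [← hinv (t ^ (j : ℕ))]
        congr 1
        ext k
        refine pow_mul_lamp ht (c k) (c k + s j) j ?_ (v (x k)) _ _ ?_ ?_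
        · exact (Fin.val_add _ _).trans (Nat.mod_eq_of_lt (hgood k).1)
        · rw [(hgood k).2, modifyOn, if_pos ((hPmem _ _ _).2 rfl)]
        · intro i hi
          rw [modifyOn, if_neg (fun h => hi ((hPmem _ _ _).1 h))]
      rw [this, sub_self, abs_zero]
      exact mul_nonneg (by linarith) (Finset.sum_nonneg fun k _ => add_nonneg (hW0 _ _) (hV0 _ _))
    · push Not at hgood
      obtain ⟨k, hk⟩ := hgood
      have h1 : 1 ≤ W j (c k) + V (x k) (a (k, c k + s j)) := by
        by_cases h : (c k : ℕ) + j < L + 1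
        · have : V (x k) (a (k, c k + s j)) = 1 := if_neg (hk h)
          have := hW0 j (c k)
          linarith
        · have : W j (c k) = 1 := if_neg h
          have := hV0 (x k) (a (k, c k + s j))
          linarith
      have h2 := Finset.single_le_sum (f := fun k => W j (c k) + V (x k) (a (k, c k + s j)))
        (fun k _ => add_nonneg (hW0 _ _) (hV0 _ _)) (Finset.mem_univ k)
      calc _ ≤ |Ψ (fun k => c k + s j) a| + |Φ c (modifyOn T' (P c j) a)| := abs_sub _ _
        _ ≤ 2 * B * 1 := by
          linarith [hB fun k => v (x k) * lamp ht (c k + s j) fun i => u (a (k, i)),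
            hB fun k => lamp ht (c k) fun i => u (modifyOn T' (P c j) a (k, i))]
        _ ≤ _ := mul_le_mul_of_nonneg_left (h1.trans h2) (by linarith)
  have herr : ∀ j : Fin J, |(𝔼 c, 𝔼 a, Ψ c a) - 𝔼 c, 𝔼 a, Φ c (modifyOn T' (P c j) a)| ≤
      2 * B * (N * (J / (L + 1) + δ)) := by
    intro j
    rw [hshift j, ← Finset.expect_sub_distrib]
    simp only [← Finset.expect_sub_distrib]
    calc _ ≤ 𝔼 c : Fin N → Fin (L + 1), 𝔼 a : Fin N × Fin (L + 1) → Ω,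
          2 * B * ∑ k, (W j (c k) + V (x k) (a (k, c k + s j))) :=
          (Finset.abs_expect_le _ _).trans <| Finset.expect_le_expect fun c _ =>
            (Finset.abs_expect_le _ _).trans <| Finset.expect_le_expect fun a _ => hpt j c a
      _ = 2 * B * ∑ k, ((𝔼 c, W j c) + 𝔼 w, V (x k) w) := by
          simp only [← Finset.mul_expect, Finset.expect_sum_comm, Finset.expect_add_distrib,
            Fintype.expect_const]
          congr 1
          refine Finset.sum_congr rfl fun k _ => ?_
          congr 1
          · exact expect_apply_eq k (W j)
          · have : ∀ c : Fin N → Fin (L + 1), 𝔼 a : Fin N × Fin (L + 1) → Ω,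
                V (x k) (a (k, c k + s j)) = 𝔼 w, V (x k) w :=
              fun c => expect_apply_eq (k, c k + s j) (V (x k))
            simp only [this, Fintype.expect_const]
      _ ≤ 2 * B * ∑ k : Fin N, ((J : ℝ) / (L + 1) + δ) := by
          refine mul_le_mul_of_nonneg_left (Finset.sum_le_sum fun k _ => ?_) (by linarith)
          refine add_le_add ((expect_wrap_le L j).trans ?_) (hT (x k))
          gcongr
          exact j.2.le
      _ = _ := by simp [mul_add]
  have hJ : Nonempty (Fin J) := ⟨0⟩
  have h1 : |(𝔼 c, 𝔼 a, Ψ c a) - 𝔼 c, 𝔼 j, 𝔼 a, Φ c (modifyOn T' (P c j) a)| ≤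
      2 * B * (N * (J / (L + 1) + δ)) := by
    rw [Finset.expect_comm (s := (Finset.univ : Finset (Fin N → Fin (L + 1))))
      (t := (Finset.univ : Finset (Fin J))),
      ← Fintype.expect_const (ι := Fin J) (𝔼 c, 𝔼 a, Ψ c a), ← Finset.expect_sub_distrib]
    exact abs_expect_le_of_forall _ _ herr
  have h2 : |(𝔼 c, 𝔼 j, 𝔼 a, Φ c (modifyOn T' (P c j) a)) - 𝔼 c, 𝔼 a, Φ c a| ≤
      √(B ^ 2 * ((C ^ N) ^ 2 / J)) := by
    rw [← Finset.expect_sub_distrib]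
    exact abs_expect_le_of_forall _ _ hLLN
  exact (abs_sub_le _ _ _).trans (add_le_add h1 h2)

end Lamplighter

/-! ### The algebraic vanishing criterion. -/

section Criterion

open scoped BigOperators

variable {G : Type*} [Group G]

theorem altCoboundary_diag {X : Type*} (n : ℕ) (f : (Fin n → X) → ℝ) (a : X) :
    altCoboundary n f (fun _ => a) = if Even n then f (fun _ => a) else 0 :=
  altCoboundary_const (X := X) n (f fun _ => a) fun _ => a

/-- A bounded invariant cocycle is, on tuples from a finite set with commuting conjugates, almost
a coboundary. -/
theorem exists_almost_primitive {H : Subgroup G} {t : G}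
    (ht : ∀ i : ℕ, 1 ≤ i → ∀ a ∈ H, ∀ b ∈ H, Commute (t ^ i * a * (t ^ i)⁻¹) b)
    (S : Finset G) (hS : ∀ a ∈ S, a ∈ H) (n : ℕ) (f : (Fin (n + 1) → G) → ℝ) (B : ℝ)
    (hB : ∀ x, |f x| ≤ B) (hinv : ∀ (g : G) x, f (fun i => g * x i) = f x)
    (hf : ∀ x, altCoboundary (n + 1) f x = 0) (ε : ℝ) (hε : 0 < ε) :
    ∃ (F : (Fin n → G) → ℝ) (c : ℝ), (∀ x, |F x| ≤ n * B) ∧ |c| ≤ B ∧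
      (∀ (g : G) x, F (fun i => g * x i) = F x) ∧
      ∀ x : Fin (n + 1) → G, (∀ i, x i ∈ S) → |c - f x - altCoboundary n F x| ≤ ε := by
  classical
  have hB0 : 0 ≤ B := (abs_nonneg _).trans (hB fun _ => 1)
  rcases S.eq_empty_or_nonempty with rfl | hne
  · refine ⟨0, 0, fun x => ?_, by simpa using hB0, fun _ _ => rfl, fun x hx => ?_⟩
    · simpa using mul_nonneg n.cast_nonneg hB0
    · exact absurd (hx 0) (Finset.notMem_empty _)
  have : Nonempty S := hne.to_subtype
  let v : S → H := fun a => ⟨a, hS a a.2⟩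
  set C : ℝ := (Nat.card S : ℝ) with hCdef
  set D : ℝ := B ^ 2 * (C ^ (n + 1)) ^ 2 with hD
  have hD0 : 0 ≤ D := by positivity
  -- `J` is chosen against the density bound and `L` against `J`; `K` makes word failure rare. The
  -- tolerance splits as `ε / 2 + ε / 4 + ε / 4`.
  obtain ⟨J, hJ⟩ := exists_nat_gt (D / (ε / 2) ^ 2)
  have hJpos : (0 : ℝ) < J := lt_of_le_of_lt (by positivity) hJ
  have : NeZero J := ⟨by
    rintro rfl
    simp at hJpos⟩
  obtain ⟨K, hK⟩ := exists_nat_gt (2 * B * (n + 1) / (ε / 4))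
  obtain ⟨L, hL⟩ := exists_nat_gt (max (J : ℝ) (2 * B * (n + 1) * J / (ε / 4)))
  obtain ⟨Ω, _, _, u, T, hC, hT⟩ := exists_random_word v K
  have hJL : J ≤ L + 1 := by
    have : (J : ℝ) < L := (le_max_left _ _).trans_lt hL
    have : J < L := by exact_mod_cast this
    omega
  let y : Fin (L + 1) × (Fin (L + 1) → Ω) → G := fun w => lamp ht w.1 (fun i => u (w.2 i))
  obtain ⟨F, hFb, hFi, hF⟩ := exists_homotopy_translate y n f B hB hinv hf
  refine ⟨F, 𝔼 w : Fin (n + 1) → Fin (L + 1) × (Fin (L + 1) → Ω), f (fun i => y (w i)), hFb,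
    abs_expect_le_of_forall _ _ fun _ => hB _, hFi, fun x hx => ?_⟩
  have key := abs_average_lamp_sub_le ht v u T C (1 / (K + 1)) hC hT (n + 1) J L hJL f B hB hinv
    (fun i => ⟨x i, hx i⟩)
  rw [hF x, abs_sub_comm]
  have h1 : √(B ^ 2 * ((C ^ (n + 1)) ^ 2 / J)) ≤ ε / 2 := by
    rw [Real.sqrt_le_left (by positivity), ← mul_div_assoc, ← hD, div_le_iff₀ hJpos]
    rw [div_lt_iff₀ (by positivity)] at hJ
    linarith
  have h2 : 2 * B * (n + 1) * (1 / (K + 1)) ≤ ε / 4 := by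
    rw [div_lt_iff₀ (by positivity)] at hK
    rw [mul_one_div, div_le_iff₀ (by positivity)]
    nlinarith
  have h3 : 2 * B * (n + 1) * (J / (L + 1)) ≤ ε / 4 := by
    have hL' := (le_max_right _ _).trans_lt hL
    rw [div_lt_iff₀ (by positivity)] at hL'
    rw [← mul_div_assoc, div_le_iff₀ (by positivity)]
    nlinarith
  push_cast at key
  have h4 : 2 * B * ((n + 1) * ((J : ℝ) / (L + 1) + 1 / (K + 1))) ≤ ε / 2 := by
    have : 2 * B * ((n + 1) * ((J : ℝ) / (L + 1) + 1 / (K + 1))) =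
      2 * B * (n + 1) * (J / (L + 1)) + 2 * B * (n + 1) * (1 / (K + 1)) := by ring
    linarith
  refine le_trans (le_of_eq ?_) (key.trans (by linarith : _ ≤ ε))
  congr 1
  simp only [y, v]
  ring

/-- The vanishing criterion: every finite subset lies in a subgroup commuting with its conjugates by
all positive powers of some element. -/
theorem boundedlyAcyclic_of_commuting_conjugates
    (h : ∀ S : Finset G, ∃ (H : Subgroup G) (t : G), (∀ a ∈ S, a ∈ H) ∧
      ∀ i : ℕ, 1 ≤ i → ∀ a ∈ H, ∀ b ∈ H, Commute (t ^ i * a * (t ^ i)⁻¹) b) :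
    BoundedlyAcyclic G := by
  classical
  intro n hn
  obtain ⟨n, rfl⟩ : ∃ k, n = k + 1 := ⟨n - 1, by omega⟩
  rw [Submodule.Quotient.subsingleton_iff, Submodule.submoduleOf_eq_top]
  rintro f ⟨⟨⟨B, hB⟩, hinv⟩, hf⟩
  have hB0 : 0 ≤ B := (abs_nonneg _).trans (hB fun _ => 1)
  have hf' : ∀ x, altCoboundary (n + 2) f x = 0 := fun x => congrFun hf x
  set D : ℝ := (n + 1) * B + B with hD
  -- The bound `D` does not depend on `S` or `ε`, as the compactness argument requires.
  have happrox : ∀ (S : Finset G) (ε : ℝ), 0 < ε → ∃ F : (Fin (n + 1) → G) → ℝ,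
      (∀ x, |F x| ≤ D) ∧ (∀ (g : G) x, F (fun i => g * x i) = F x) ∧
      ∀ x : Fin (n + 2) → G, (∀ i, x i ∈ S) → |altCoboundary (n + 1) F x - f x| ≤ ε := by
    intro S ε hε
    -- The constant `c` is a coboundary only when `n + 1` is even. Otherwise the estimate at the
    -- constant tuple `1`, where both `f` and the coboundary of `F` vanish, shows that `c` is small.
    obtain ⟨H, t, hS, ht⟩ := h (insert 1 S)
    obtain ⟨F, c, hFb, hc, hFi, hF⟩ :=
      exists_almost_primitive ht (insert 1 S) hS (n + 1) f B hB hinv hf' (ε / 2) (half_pos hε)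
    refine ⟨fun z => c - F z, fun x => ?_, fun g x => congrArg (c - ·) (hFi g x), fun x hx => ?_⟩
    · have := hFb x
      push_cast at this
      refine (abs_sub _ _).trans ?_
      linarith
    · have hx' := hF x fun i => Finset.mem_insert_of_mem (hx i)
      rw [altCoboundary_sub, altCoboundary_const]
      split_ifs with he
      · rw [show c - altCoboundary (n + 1) F x - f x = c - f x - altCoboundary (n + 1) F x by ring]
        linarith
      · have h1 := hF (fun _ => 1) fun i => Finset.mem_insert_self _ _
        have h2 := hf' fun _ => 1
        rw [altCoboundary_diag, if_pos (by rwa [Nat.even_add_one])] at h2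
        rw [altCoboundary_diag, if_neg he, h2, sub_zero, sub_zero] at h1
        rw [abs_le] at *
        constructor <;> linarith
  let s : Set ((Fin (n + 1) → G) → ℝ) :=
    {F | (∀ x, |F x| ≤ D) ∧ ∀ (g : G) x, F (fun i => g * x i) = F x}
  have hs : IsCompact s := by
    have h1 : s = (Set.univ.pi fun _ => Set.Icc (-D) D) ∩
        {F | ∀ (g : G) x, F (fun i => g * x i) = F x} := by
      ext F
      simp only [s, abs_le, Set.mem_ofPred_eq, Set.mem_inter_iff, Set.mem_univ_pi, Set.mem_Icc]
    rw [h1]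
    refine (isCompact_univ_pi fun _ => isCompact_Icc).inter_right ?_
    simp only [Set.ofPred_forall]
    exact isClosed_iInter fun g => isClosed_iInter fun x =>
      isClosed_eq (continuous_apply _) (continuous_apply _)
  let C : (Fin (n + 2) → G) × ℕ → Set ((Fin (n + 1) → G) → ℝ) := fun p =>
    {F | |altCoboundary (n + 1) F p.1 - f p.1| ≤ 1 / (p.2 + 1)}
  have hne : (s ∩ ⋂ p, C p).Nonempty := by
    refine hs.inter_iInter_nonempty C (fun p => ?_) fun P => ?_
    · refine isClosed_le (continuous_abs.comp (Continuous.sub ?_ continuous_const)) continuous_const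
      exact continuous_finsetSum _ fun i _ => continuous_const.mul (continuous_apply _)
    · obtain ⟨F, hFb, hFi, hF⟩ := happrox (P.biUnion fun p => Finset.univ.image p.1)
        (1 / ((P.sup fun p => p.2 : ℕ) + 1)) (by positivity)
      refine ⟨F, ⟨hFb, hFi⟩, Set.mem_iInter₂.2 fun p hp => ?_⟩
      refine (hF p.1 fun i => Finset.mem_biUnion.2 ⟨p, hp, by simp⟩).trans ?_
      have : p.2 ≤ P.sup fun p => p.2 := Finset.le_sup (f := fun p : _ × ℕ => p.2) hp
      gcongr
  obtain ⟨F, ⟨hFb, hFi⟩, hF⟩ := hne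
  refine ⟨F, ⟨⟨D, hFb⟩, hFi⟩, ?_⟩
  ext x
  change altCoboundary (n + 1) F x = f x
  rw [Set.mem_iInter] at hF
  have h0 : |altCoboundary (n + 1) F x - f x| ≤ 0 :=
    ge_of_tendsto' tendsto_one_div_add_atTop_nhds_zero_nat fun k => hF (x, k)
  exact sub_eq_zero.1 (abs_nonpos_iff.1 h0)

end Criterion

/-! ### From displacement of compact sets to commuting conjugates. -/

section Displacement

variable {G X : Type*} [Group G] [TopologicalSpace X]

/-- The conjugate moves only points of the image of `K` under `t ^ i`, which is disjoint from `K`;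
permutations with disjoint supports commute. -/
theorem commute_of_displaced {φ : G →* Equiv.Perm X} (hφ : Function.Injective φ) {K : Set X} {t : G}
    (ht : ∀ i : ℕ, 1 ≤ i → ∀ x ∈ K, (φ t ^ i) x ∉ K) {a b : G} (ha : a ∈ supportedIn φ K)
    (hb : b ∈ supportedIn φ K) {i : ℕ} (hi : 1 ≤ i) : Commute (t ^ i * a * (t ^ i)⁻¹) b := by
  have hfix : ∀ g ∈ supportedIn φ K, ∀ x, x ∉ K → φ g x = x := by
    intro g hg x hx
    by_contra h
    exact hx (hg (subset_closure h))
  refine Commute.of_map hφ (Equiv.Perm.Disjoint.commute fun x => ?_)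
  by_cases hx : x ∈ K
  · left
    simp only [map_mul, map_inv, map_pow, Equiv.Perm.mul_apply]
    rw [hfix a ha, ← Equiv.Perm.mul_apply, mul_inv_cancel, Equiv.Perm.one_apply]
    intro h
    have := ht i hi _ h
    exact this (by rwa [← Equiv.Perm.mul_apply, mul_inv_cancel])
  · exact Or.inr (hfix b hb x hx)

/-- A group of compactly supported transformations is boundedly acyclic as soon as every compact
set is displaced from itself by all positive powers of one element of the group. -/
theorem boundedlyAcyclic_of_displacement (φ : G →* Equiv.Perm X) (hφ : Function.Injective φ)
    (Γ : Subgroup G) (hΓ : Γ ≤ compactSupportSubgroup φ)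
    (h : ∀ K : Set X, IsCompact K → ∃ t ∈ Γ, ∀ i : ℕ, 1 ≤ i → ∀ x ∈ K, (φ t ^ i) x ∉ K) :
    BoundedlyAcyclic Γ := by
  refine boundedlyAcyclic_of_commuting_conjugates fun S => ?_
  obtain ⟨t, htΓ, ht⟩ := h (⋃ g ∈ S, permSupport (φ (g : G)))
    (S.isCompact_biUnion fun g _ => hΓ g.2)
  refine ⟨(supportedIn φ (⋃ g ∈ S, permSupport (φ (g : G)))).subgroupOf Γ, ⟨t, htΓ⟩,
    fun a ha => ?_, fun i hi a ha b hb => ?_⟩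
  · exact Set.subset_biUnion_of_mem (u := fun g : Γ => permSupport (φ (g : G))) ha
  · exact Subtype.ext (commute_of_displaced hφ ht ha hb hi)

theorem compactSupportNeutral_le [TopologicalSpace G] (φ : G →* Equiv.Perm X)
    (hG : ∀ g : G, Continuous fun h : G => h * g) :
    compactSupportNeutral φ hG ≤ compactSupportSubgroup φ := by
  rintro g ⟨K, hK, hg⟩
  exact hK.of_isClosed_subset isClosed_closure (connectedComponentIn_subset _ _ hg)

theorem mem_compactSupportNeutral_of_path [TopologicalSpace G] (φ : G →* Equiv.Perm X)
    (hG : ∀ g : G, Continuous fun h : G => h * g) {I : Type*} [TopologicalSpace I]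
    [PreconnectedSpace I] (F : I → G) (hF : Continuous F) (i₀ i : I) (h₀ : F i₀ = 1) {K : Set X}
    (hK : IsCompact K) (hFK : ∀ i, F i ∈ supportedIn φ K) :
    F i ∈ compactSupportNeutral φ hG :=
  ⟨K, hK, (isPreconnected_range hF).subset_connectedComponentIn ⟨i₀, h₀⟩
    (Set.range_subset_iff.2 hFK) ⟨i, rfl⟩⟩

end Displacement

/-! ### Cut-off translations of a vector space. -/

section Push

open Set Metric

variable {V : Type*} [NormedAddCommGroup V] [NormedSpace ℝ V]

/-- A smooth contraction added to the identity gives a diffeomorphism. -/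
theorem exists_homeomorph_id_add [CompleteSpace V] {g : V → V} (hg : ContDiff ℝ ∞ g) {c : NNReal}
    (hgc : LipschitzWith c g) (hc : c < 1) :
    ∃ τ : V ≃ₜ V, ContDiff ℝ ∞ τ ∧ ContDiff ℝ ∞ τ.symm ∧ ∀ x, τ x = x + g x := by
  have happ : ApproximatesLinearOn (fun x => x + g x)
      ((ContinuousLinearEquiv.refl ℝ V : V ≃L[ℝ] V) : V →L[ℝ] V) univ c := by
    intro x _ y _
    have := hgc.norm_sub_le x y
    have h : x + g x - (y + g y) - (x - y) = g x - g y := by abel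
    change ‖x + g x - (y + g y) - (x - y)‖ ≤ _
    rwa [h]
  have hN : Subsingleton V ∨
      c < ‖((ContinuousLinearEquiv.refl ℝ V).symm : V →L[ℝ] V)‖₊⁻¹ := by
    rcases subsingleton_or_nontrivial V with h | h
    · exact Or.inl h
    · right
      have : ‖((ContinuousLinearEquiv.refl ℝ V).symm : V →L[ℝ] V)‖₊ = 1 := by
        ext
        exact ContinuousLinearMap.norm_id
      rwa [this, inv_one]
  let τ : V ≃ₜ V := happ.toHomeomorph _ hN
  have hτ : ∀ x, τ x = x + g x := fun x => rfl
  have hsm : ContDiff ℝ ∞ τ := contDiff_id.add hg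
  have hnorm : ∀ x, ‖-fderiv ℝ g x‖ < 1 := fun x => by
    rw [norm_neg]
    exact (norm_fderiv_le_of_lipschitz ℝ hgc).trans_lt (by exact_mod_cast hc)
  -- The derivative `1 + g'` is invertible by the Neumann series, so the inverse is smooth.
  refine ⟨τ, hsm, τ.contDiff_symm (f₀' := fun x =>
    ContinuousLinearEquiv.ofUnit (Units.oneSub (-fderiv ℝ g x) (hnorm x))) (fun x => ?_) hsm, hτ⟩
  have h1 : HasFDerivAt τ (ContinuousLinearMap.id ℝ V + fderiv ℝ g x) x :=
    (hasFDerivAt_id x).add (hg.differentiable (by simp) x).hasFDerivAt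
  convert h1 using 1
  ext v
  change (1 - -fderiv ℝ g x) v = _
  simp

/-- While the total displacement is at most `2ρ + 1`, the point stays in the ball of radius `3ρ + 1`
and advances by a full `s`. Once the displacement reaches `2ρ + 1` it never decreases, and the norm
is at least `ρ + 1`. -/
theorem lt_norm_iterate_push {η : V → ℝ} {e : V} (he : ‖e‖ = 1) (h0 : ∀ x, 0 ≤ η x) {ρ s : ℝ}
    (hs : 0 ≤ s) (h1 : ∀ x, ‖x‖ ≤ 3 * ρ + 1 → η x = 1) {τ : V → V}
    (hτ : ∀ x, τ x = x + (s * η x) • e) {k : ℕ} (hk : 2 * ρ + 1 ≤ k * s) {x : V} (hx : ‖x‖ ≤ ρ) :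
    ρ < ‖τ^[k] x‖ := by
  have hρ : 0 ≤ ρ := (norm_nonneg x).trans hx
  have key : ∀ j : ℕ, ∃ a : ℝ, 0 ≤ a ∧ min (j * s) (2 * ρ + 1) ≤ a ∧ τ^[j] x = x + a • e := by
    intro j
    induction j with
    | zero => exact ⟨0, le_rfl, by simp, by simp⟩
    | succ j ih =>
      obtain ⟨a, ha0, ha, hja⟩ := ih
      have hnn : 0 ≤ s * η (x + a • e) := mul_nonneg hs (h0 _)
      refine ⟨a + s * η (x + a • e), by linarith, ?_, ?_⟩
      · by_cases h : a ≤ 2 * ρ + 1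
        · rw [h1, mul_one]
          · push_cast
            rw [min_le_iff] at ha ⊢
            rcases ha with ha | ha
            · left; linarith
            · right; linarith
          · refine (norm_add_le _ _).trans ?_
            rw [norm_smul, he, mul_one, Real.norm_of_nonneg ha0]
            linarith
        · exact (min_le_right _ _).trans (by linarith)
      · rw [Function.iterate_succ_apply', hja, hτ, add_smul, add_assoc]
  obtain ⟨a, ha0, ha, hka⟩ := key k
  rw [min_eq_right hk] at ha
  rw [hka]
  have h2 : ‖a • e‖ = a := by rw [norm_smul, he, mul_one, Real.norm_of_nonneg ha0]
  have h3 := norm_sub_le (x + a • e) x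
  rw [add_sub_cancel_left, h2] at h3
  linarith

/-- An isotopy of compactly supported diffeomorphisms, whose end displaces the ball of radius `ρ`
off itself under all large iterates. -/
theorem exists_push [FiniteDimensional ℝ V] [HasContDiffBump V] {e : V} (he : ‖e‖ = 1) {ρ : ℝ}
    (hρ : 0 ≤ ρ) :
    ∃ (s₀ R : ℝ) (P : ℝ × V → V) (τ : Icc 0 s₀ → V ≃ₜ V) (k₀ : ℕ), 0 ≤ s₀ ∧ ContDiff ℝ ∞ P ∧
      (∀ s, ContDiff ℝ ∞ (τ s)) ∧ (∀ s, ContDiff ℝ ∞ (τ s).symm) ∧ (∀ s x, τ s x = P (s, x)) ∧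
      (∀ x, P (0, x) = x) ∧ (∀ s x, R < ‖x‖ → P (s, x) = x) ∧
      ∀ s : Icc 0 s₀, (s : ℝ) = s₀ → ∀ k : ℕ, k₀ ≤ k → ∀ x, ‖x‖ ≤ ρ → ρ < ‖(τ s)^[k] x‖ := by
  have : CompleteSpace V := FiniteDimensional.complete ℝ V
  let η : ContDiffBump (0 : V) := ⟨3 * ρ + 1, 3 * ρ + 2, by linarith, by linarith⟩
  have hη : ContDiff ℝ ∞ η := η.contDiff
  obtain ⟨C, hC⟩ := hη.lipschitzWith_of_hasCompactSupport η.hasCompactSupport (by simp)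
  -- Keeps the perturbation a strict contraction for every `s ≤ s₀`.
  let s₀ : ℝ := 1 / (C + 1)
  have hs₀ : 0 < s₀ := by positivity
  have hg : ∀ s : ℝ, LipschitzWith (‖s‖₊ * C) fun x => (s * η x) • e := by
    intro s
    refine LipschitzWith.of_dist_le_mul fun x y => ?_
    rw [dist_eq_norm, ← sub_smul, norm_smul, he, mul_one, ← mul_sub, norm_mul]
    push_cast
    rw [mul_assoc]
    exact mul_le_mul_of_nonneg_left (hC.norm_sub_le x y |>.trans_eq (by rw [dist_eq_norm]))
      (norm_nonneg s)
  have hc : ∀ s : Icc 0 s₀, ‖(s : ℝ)‖₊ * C < 1 := by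
    rintro ⟨s, hs0, hs⟩
    rw [← NNReal.coe_lt_coe]
    push_cast
    rw [Real.norm_of_nonneg hs0]
    calc s * (C : ℝ) ≤ s₀ * C := mul_le_mul_of_nonneg_right hs C.2
      _ < 1 := by
        simp only [s₀]
        rw [one_div, inv_mul_lt_one₀ (by positivity)]
        linarith
  have hgs : ∀ s : ℝ, ContDiff ℝ ∞ fun x => (s * η x) • e := fun s =>
    (contDiff_const.mul hη).smul contDiff_const
  choose τ h1 h2 h3 using fun s : Icc 0 s₀ => exists_homeomorph_id_add (hgs s) (hg s) (hc s)
  obtain ⟨k₀, hk₀⟩ := exists_nat_gt ((2 * ρ + 1) / s₀)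
  rw [div_lt_iff₀ hs₀] at hk₀
  refine ⟨s₀, 3 * ρ + 2, fun p => p.2 + (p.1 * η p.2) • e, τ, k₀, hs₀.le, ?_, h1, h2, h3, ?_, ?_, ?_⟩
  · exact contDiff_snd.add ((contDiff_fst.mul (hη.comp contDiff_snd)).smul contDiff_const)
  · simp
  · intro s x hx
    have : η x = 0 := η.zero_of_le_dist (by simpa using hx.le)
    simp [this]
  · intro s hs k hk x hx
    refine lt_norm_iterate_push he (fun x => η.nonneg) s.2.1 (fun x hx => ?_) (h3 s) ?_ hx
    · exact η.one_of_mem_closedBall (by simpa using hx)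
    · rw [hs]
      refine hk₀.le.trans (mul_le_mul_of_nonneg_right (by exact_mod_cast hk) hs₀.le)

end Push

/-! ### Derivatives in one variable of a jointly smooth map. -/

section PartialDerivatives

variable {A E F : Type*} [NormedAddCommGroup A] [NormedSpace ℝ A] [NormedAddCommGroup E]
  [NormedSpace ℝ E] [NormedAddCommGroup F] [NormedSpace ℝ F]

theorem iteratedFDeriv_partial {h : A × E → F} {s : A} {x : E} {k j : ℕ}
    (hh : ContDiffAt ℝ k h (s, x)) (hj : j ≤ k) :
    iteratedFDeriv ℝ j (fun y => h (s, y)) x =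
      (iteratedFDeriv ℝ j h (s, x)).compContinuousLinearMap
        fun _ => ContinuousLinearMap.inr ℝ A E := by
  obtain ⟨u, hu, hhu⟩ := hh.contDiffOn le_rfl (by simp)
  obtain ⟨v, hvu, hv, hxv⟩ := mem_nhds_iff.1 hu
  -- Translating by `(s, 0)` turns the affine slice `y ↦ (s, y)` into the linear map `inr`, to which
  -- the chain rule for iterated derivatives applies.
  let f : A × E → F := fun q => h (q + (s, 0))
  have htr : ContDiff ℝ k fun q : A × E => q + (s, 0) := contDiff_id.add contDiff_const
  let w : Set (A × E) := (fun q => q + (s, 0)) ⁻¹' v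
  have hw : IsOpen w := hv.preimage htr.continuous
  have hf : ContDiffOn ℝ k f w := (hhu.mono hvu).comp htr.contDiffOn fun q hq => hq
  have hw' : IsOpen (ContinuousLinearMap.inr ℝ A E ⁻¹' w) :=
    hw.preimage (ContinuousLinearMap.inr ℝ A E).continuous
  have hxw : ContinuousLinearMap.inr ℝ A E x ∈ w := by simpa [w] using hxv
  have key := (ContinuousLinearMap.inr ℝ A E).iteratedFDerivWithin_comp_right hf hw.uniqueDiffOn
    hw'.uniqueDiffOn hxw (i := j) (by exact_mod_cast hj)
  rw [iteratedFDerivWithin_of_isOpen j hw' hxw, iteratedFDerivWithin_of_isOpen j hw hxw] at key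
  have h1 : f ∘ ContinuousLinearMap.inr ℝ A E = fun y => h (s, y) := by
    ext y
    simp [f]
  have h2 : iteratedFDeriv ℝ j f (ContinuousLinearMap.inr ℝ A E x) =
      iteratedFDeriv ℝ j h (s, x) := by
    rw [iteratedFDeriv_comp_add_right]
    simp
  rw [← h1, key, h2]

theorem continuousAt_iteratedFDeriv_partial {h : A × E → F} {p : A × E} {k j : ℕ}
    (hh : ContDiffAt ℝ k h p) (hj : j ≤ k) :
    ContinuousAt (fun q : A × E => iteratedFDeriv ℝ j (fun y => h (q.1, y)) q.2) p := by
  have h1 : (fun q : A × E => iteratedFDeriv ℝ j (fun y => h (q.1, y)) q.2) =ᶠ[𝓝 p]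
      fun q => ContinuousMultilinearMap.compContinuousLinearMapL
        (fun _ => ContinuousLinearMap.inr ℝ A E) (iteratedFDeriv ℝ j h q) := by
    -- Differentiability at a point spreads to a neighbourhood because the order `k` is finite.
    filter_upwards [hh.eventually (by simp)] with q hq
    exact iteratedFDeriv_partial hq hj
  rw [continuousAt_congr h1]
  exact (ContinuousLinearMap.continuous _).continuousAt.comp
    (hh.continuousAt_iteratedFDeriv (by exact_mod_cast hj))

end PartialDerivatives

/-! ### Smooth isotopies are continuous paths of diffeomorphisms. -/

section Isotopy

open Set

variable {d : ℕ} {r : ℕ∞} {Z : Type*} [TopologicalSpace Z]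
  [ChartedSpace (EuclideanSpace ℝ (Fin d)) Z]

/-- The restriction to a set of parameters of a jointly `C^r` family of self-maps which are all
diffeomorphisms is a continuous path for the `C^r`-topology. -/
theorem continuous_diff_of_contMDiff {S : Set ℝ} (Q : ℝ × Z → Z)
    (hQ : ContMDiff (𝓘(ℝ, ℝ).prod (𝓡 d)) (𝓡 d) r Q) (F : S → DiffR d r Z)
    (hF : ∀ s z, F s z = Q (s, z)) : Continuous F := by
  refine continuous_generateFrom_iff.2 ?_
  rintro _ ⟨f, a, b, K, k, ε, ha, hb, hK, hKa, hfK, hk, hε, rfl⟩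
  rw [isOpen_iff_mem_nhds]
  intro s hs
  have hkr : ((k : ℕ) : ℕ∞ω) ≤ (r : ℕ∞ω) := by exact_mod_cast hk
  obtain ⟨hs1, hs2⟩ := hs
  have hQs : Continuous fun p : S × Z => Q (p.1, p.2) :=
    hQ.continuous.comp (continuous_subtype_val.prodMap continuous_id)
  -- By compactness of `K`, both defining conditions need only be checked near each point `(s, z)`.
  have hev1 : ∀ᶠ s' in 𝓝 s, ∀ z ∈ K, F s' z ∈ b.source := by
    refine hK.eventually_forall_of_forall_eventually fun z hz => ?_
    have h1 : F s z ∈ b.source := hs1 ⟨z, hz, rfl⟩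
    simp only [hF] at h1 ⊢
    exact hQs.continuousAt.preimage_mem_nhds (b.open_source.mem_nhds h1)
  have hev2 : ∀ j : ℕ, j ≤ k → ∀ᶠ s' in 𝓝 s, ∀ z ∈ K,
      ‖iteratedFDeriv ℝ j (b ∘ F s' ∘ a.symm) (a z) -
        iteratedFDeriv ℝ j (b ∘ f ∘ a.symm) (a z)‖ < ε := by
    intro j hj
    refine hK.eventually_forall_of_forall_eventually fun z hz => ?_
    have haz : a z ∈ a.target := a.map_source (hKa hz)
    have hsymm : a.symm (a z) = z := a.left_inv (hKa hz)
    have hacont : ContinuousAt a z := a.continuousAt (hKa hz)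
    have hasymm : ContMDiffAt 𝓘(ℝ, EuclideanSpace ℝ (Fin d)) (𝓡 d) r a.symm (a z) :=
      contMDiffAt_symm_of_mem_maximalAtlas ha haz
    let h : ℝ × EuclideanSpace ℝ (Fin d) → EuclideanSpace ℝ (Fin d) := fun p =>
      b (Q (p.1, a.symm p.2))
    have hh : ContDiffAt ℝ k h ((s : ℝ), a z) := by
      refine ContDiffAt.of_le (n := r) ?_ hkr
      rw [← contMDiffAt_iff_contDiffAt]
      have h1 : F s z ∈ b.source := hs1 ⟨z, hz, rfl⟩
      have h2 : ContMDiffAt 𝓘(ℝ, ℝ × EuclideanSpace ℝ (Fin d)) (𝓘(ℝ, ℝ).prod (𝓡 d)) r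
          (fun p : ℝ × EuclideanSpace ℝ (Fin d) => (p.1, a.symm p.2)) ((s : ℝ), a z) := by
        refine ContMDiffAt.prodMk (contDiff_fst.contMDiff.contMDiffAt) ?_
        exact ContMDiffAt.comp (x := ((s : ℝ), a z)) (g := a.symm) (f := Prod.snd) hasymm
          contDiff_snd.contMDiff.contMDiffAt
      have h3 := ContMDiffAt.comp ((s : ℝ), a z) hQ.contMDiffAt h2
      refine ContMDiffAt.comp (g := b) ((s : ℝ), a z) ?_ h3
      refine contMDiffAt_of_mem_maximalAtlas hb ?_
      simpa [hsymm, ← hF] using h1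
    have hc1 := continuousAt_iteratedFDeriv_partial hh hj
    have hc2 : ContinuousAt (fun p : S × Z =>
        iteratedFDeriv ℝ j (fun y => h (p.1, y)) (a p.2)) (s, z) :=
      ContinuousAt.comp (x := (s, z)) (f := fun p : S × Z => ((p.1 : ℝ), a p.2)) hc1
        ((continuous_subtype_val.comp continuous_fst).continuousAt.prodMk
          (hacont.comp continuousAt_snd))
    have hc3 : ContinuousAt (fun p : S × Z => iteratedFDeriv ℝ j (b ∘ f ∘ a.symm) (a p.2))
        (s, z) := by
      have hd : ContDiffAt ℝ k (b ∘ f ∘ a.symm) (a z) := by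
        refine ContDiffAt.of_le (n := r) ?_ hkr
        rw [← contMDiffAt_iff_contDiffAt]
        refine ContMDiffAt.comp (g := b) (a z) ?_
          (ContMDiffAt.comp (a z) f.contMDiff.contMDiffAt hasymm)
        refine contMDiffAt_of_mem_maximalAtlas hb (hfK ⟨z, hz, ?_⟩)
        rw [Function.comp_apply, hsymm]
      exact ContinuousAt.comp (x := (s, z)) (f := fun p : S × Z => a p.2)
        (hd.continuousAt_iteratedFDeriv (by exact_mod_cast hj)) (hacont.comp continuousAt_snd)
    have hfun : ∀ s' : S, b ∘ F s' ∘ a.symm = fun y => h (s', y) := fun s' =>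
      funext fun y => congrArg b (hF s' _)
    simp only [hfun] at hs2 ⊢
    exact (hc2.sub hc3).norm.eventually_lt_const (hs2 j hj z hz)
  have hev3 : ∀ᶠ s' in 𝓝 s, ∀ j ∈ Finset.range (k + 1), ∀ z ∈ K,
      ‖iteratedFDeriv ℝ j (b ∘ F s' ∘ a.symm) (a z) -
        iteratedFDeriv ℝ j (b ∘ f ∘ a.symm) (a z)‖ < ε :=
    (Filter.eventually_all_finset _).2 fun j hj => hev2 j (Nat.lt_succ_iff.1 (Finset.mem_range.1 hj))
  filter_upwards [hev1, hev3] with s' h1 h3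
  refine ⟨?_, fun j hj => h3 j (Finset.mem_range.2 (Nat.lt_succ_iff.2 hj))⟩
  rintro _ ⟨z, hz, rfl⟩
  exact h1 z hz

theorem continuous_homeo_of_continuous {S X : Type*} [TopologicalSpace S] [TopologicalSpace X]
    (F : S → X ≃ₜ X) (hF : Continuous fun p : S × X => F p.1 p.2) : Continuous F :=
  continuous_induced_rng.2 (ContinuousMap.continuous_of_continuous_uncurry _ hF)

end Isotopy

/-! ### The displacing element and the theorem. -/

section Main

open Set

/-- In a manifold diffeomorphic to `M × ℝⁿ` with `M` compact, every compact set is displaced from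
itself by all positive powers of a diffeomorphism isotopic to the identity with compact support. -/
theorem exists_displacing_diffeo (r : ℕ∞) {m n d : ℕ} (hn : 1 ≤ n)
    {M : Type*} [TopologicalSpace M] [CompactSpace M]
    [ChartedSpace (EuclideanSpace ℝ (Fin m)) M]
    {Z : Type*} [TopologicalSpace Z]
    [ChartedSpace (EuclideanSpace ℝ (Fin d)) Z] [IsManifold (𝓡 d) r Z]
    (Φ : Diffeomorph (𝓡 d) ((𝓡 m).prod (𝓡 n)) Z (M × EuclideanSpace ℝ (Fin n)) r)
    {K : Set Z} (hK : IsCompact K) :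
    ∃ t ∈ DiffC0 d r Z, ∃ t' ∈ HomeoC0 Z, diffPerm d r Z t = homeoPerm Z t' ∧
      ∀ i : ℕ, 1 ≤ i → ∀ x ∈ K, (diffPerm d r Z t ^ i) x ∉ K := by
  have hcont : Continuous fun z => (Φ z).2 := continuous_snd.comp Φ.continuous
  obtain ⟨ρ', hρ'⟩ := (hK.image hcont).isBounded.exists_norm_le
  obtain ⟨ρ, hρ0, hρ⟩ : ∃ ρ : ℝ, 0 ≤ ρ ∧ ∀ z ∈ K, ‖(Φ z).2‖ ≤ ρ :=
    ⟨max ρ' 0, le_max_right _ _, fun z hz => (hρ' _ ⟨z, hz, rfl⟩).trans (le_max_left _ _)⟩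
  have he : ‖EuclideanSpace.single (⟨0, hn⟩ : Fin n) (1 : ℝ)‖ = 1 := by simp
  obtain ⟨s₀, R, P, τ, k₀, hs₀, hP, hτ1, hτ2, hτP, hP0, hPR, hpush⟩ := exists_push he hρ0
  have hr : (r : ℕ∞ω) ≤ ∞ := by exact_mod_cast le_top
  let T : Icc 0 s₀ → Diffeomorph (𝓡 n) (𝓡 n) (EuclideanSpace ℝ (Fin n))
      (EuclideanSpace ℝ (Fin n)) r := fun s =>
    { toEquiv := (τ s).toEquiv
      contMDiff_toFun := ((hτ1 s).of_le hr).contMDiff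
      contMDiff_invFun := ((hτ2 s).of_le hr).contMDiff }
  let F : Icc 0 s₀ → DiffR d r Z := fun s =>
    Φ.trans (((Diffeomorph.refl (𝓡 m) M r).prodCongr (T s)).trans Φ.symm)
  let Q : ℝ × Z → Z := fun p => Φ.symm ((Φ p.2).1, P (p.1, (Φ p.2).2))
  have hFQ : ∀ s z, F s z = Q (s, z) := fun s z => by
    simp only [Q, ← hτP]
    rfl
  have hQ : ContMDiff (𝓘(ℝ, ℝ).prod (𝓡 d)) (𝓡 d) r Q := by
    have h1 : ContMDiff (𝓘(ℝ, ℝ).prod (𝓡 d)) ((𝓡 m).prod (𝓡 n)) r fun p : ℝ × Z => Φ p.2 :=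
      Φ.contMDiff.comp contMDiff_snd
    have h2 : ContMDiff (𝓘(ℝ, ℝ).prod (𝓡 d)) (𝓡 n) r fun p : ℝ × Z => P (p.1, (Φ p.2).2) :=
      (hP.of_le hr).contMDiff.comp (contMDiff_fst.prodMk_space (contMDiff_snd.comp h1))
    exact Φ.symm.contMDiff.comp ((contMDiff_fst.comp h1).prodMk h2)
  let K' : Set Z := Φ ⁻¹' (univ ×ˢ Metric.closedBall 0 R)
  have hK' : IsCompact K' :=
    Φ.toHomeomorph.isCompact_preimage.2 (isCompact_univ.prod (isCompact_closedBall _ _))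
  have hK'c : IsClosed K' := (isClosed_univ.prod Metric.isClosed_closedBall).preimage Φ.continuous
  have hsupp : ∀ s, F s ∈ supportedIn (diffPerm d r Z) K' := by
    intro s
    refine closure_minimal (fun z hz => ?_) hK'c
    by_contra h
    refine hz ?_
    have hR : R < ‖(Φ z).2‖ := by simpa [K'] using h
    have : F s z = z := by
      rw [hFQ]
      simp only [Q, hPR _ _ hR]
      exact Φ.symm_apply_apply z
    exact this
  have hI : PreconnectedSpace (Icc 0 s₀) := Subtype.preconnectedSpace isPreconnected_Icc
  let i₀ : Icc 0 s₀ := ⟨0, left_mem_Icc.2 hs₀⟩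
  let i₁ : Icc 0 s₀ := ⟨s₀, right_mem_Icc.2 hs₀⟩
  have hF0 : ∀ z, F i₀ z = z := fun z => by
    rw [hFQ]
    simp only [Q, i₀, hP0]
    exact Φ.symm_apply_apply z
  have hmem : F i₁ ∈ DiffC0 d r Z :=
    mem_compactSupportNeutral_of_path _ _ F (continuous_diff_of_contMDiff Q hQ F hFQ) i₀ i₁
      (Diffeomorph.ext hF0) hK' hsupp
  have hmem' : (F i₁).toHomeomorph ∈ HomeoC0 Z := by
    refine mem_compactSupportNeutral_of_path _ _ (fun s => (F s).toHomeomorph)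
      (continuous_homeo_of_continuous _ ?_) i₀ i₁ (Homeomorph.ext hF0) hK' hsupp
    have : Continuous fun p : Icc 0 s₀ × Z => Q (p.1, p.2) :=
      hQ.continuous.comp (continuous_subtype_val.prodMap continuous_id)
    exact this.congr fun p => (hFQ p.1 p.2).symm
  have hiter : ∀ (k : ℕ) (z : Z),
      (Φ ((diffPerm d r Z (F i₁) ^ k) z)).2 = (τ i₁)^[k] (Φ z).2 := by
    intro k
    induction k with
    | zero => exact fun z => rfl
    | succ k ih =>
      intro z
      rw [pow_succ, Equiv.Perm.mul_apply, ih, Function.iterate_succ_apply]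
      congr 1
      exact congrArg Prod.snd (Φ.apply_symm_apply _)
  -- Every positive power of this element is an iterate of the push of order at least `k₀`.
  refine ⟨F i₁ ^ (k₀ + 1), pow_mem hmem _, (F i₁).toHomeomorph ^ (k₀ + 1), pow_mem hmem' _, ?_,
    fun i hi x hx hx' => ?_⟩
  · rw [map_pow, map_pow]
    rfl
  · rw [map_pow, ← pow_mul] at hx'
    have h1 := hρ _ hx'
    rw [hiter] at h1
    exact absurd h1 (not_le.2 (hpush i₁ rfl _ (by nlinarith) _ (hρ x hx)))

end Main

theorem mainTheorem6 (r : ℕ∞) (m n d : ℕ) (hn : 1 ≤ n)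
    (M : Type*) [TopologicalSpace M] [T2Space M] [CompactSpace M]
    [ChartedSpace (EuclideanSpace ℝ (Fin m)) M] [IsManifold (𝓡 m) r M]
    (Z : Type*) [TopologicalSpace Z]
    [ChartedSpace (EuclideanSpace ℝ (Fin d)) Z] [IsManifold (𝓡 d) r Z]
    (Φ : Diffeomorph (𝓡 d) ((𝓡 m).prod (𝓡 n)) Z (M × EuclideanSpace ℝ (Fin n)) r) :
    BoundedlyAcyclic (HomeoC Z) ∧ BoundedlyAcyclic (HomeoC0 Z) ∧
      BoundedlyAcyclic (DiffC d r Z) ∧ BoundedlyAcyclic (DiffC0 d r Z) := by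
  have hinj : Function.Injective (homeoPerm Z) := fun f g h =>
    Homeomorph.ext fun z => congrArg (fun σ : Equiv.Perm Z => σ z) h
  have hinj' : Function.Injective (diffPerm d r Z) := fun f g h =>
    Diffeomorph.ext fun z => congrArg (fun σ : Equiv.Perm Z => σ z) h
  have hle : HomeoC0 Z ≤ HomeoC Z := compactSupportNeutral_le _ _
  have hle' : DiffC0 d r Z ≤ DiffC d r Z := compactSupportNeutral_le _ _
  have hh : ∀ K : Set Z, IsCompact K → ∃ t ∈ HomeoC0 Z, ∀ i : ℕ, 1 ≤ i → ∀ x ∈ K,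
      (homeoPerm Z t ^ i) x ∉ K := by
    intro K hK
    obtain ⟨t, -, t', ht', htt', h⟩ := exists_displacing_diffeo r hn Φ hK
    exact ⟨t', ht', htt' ▸ h⟩
  have hd : ∀ K : Set Z, IsCompact K → ∃ t ∈ DiffC0 d r Z, ∀ i : ℕ, 1 ≤ i → ∀ x ∈ K,
      (diffPerm d r Z t ^ i) x ∉ K := by
    intro K hK
    obtain ⟨t, ht, -, -, -, h⟩ := exists_displacing_diffeo r hn Φ hK
    exact ⟨t, ht, h⟩
  -- The displacing elements already lie in the neutral components, so they serve the full groups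
  -- too.
  refine ⟨boundedlyAcyclic_of_displacement _ hinj _ le_rfl fun K hK => ?_,
    boundedlyAcyclic_of_displacement _ hinj _ hle hh,
    boundedlyAcyclic_of_displacement _ hinj' _ le_rfl fun K hK => ?_,
    boundedlyAcyclic_of_displacement _ hinj' _ hle' hd⟩
  · obtain ⟨t, ht, h⟩ := hh K hK
    exact ⟨t, hle ht, h⟩
  · obtain ⟨t, ht, h⟩ := hd K hK
    exact ⟨t, hle' ht, h⟩
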